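/- Let $(Y,d_Y)$ be a compact metric space with a continuous flow $(y,t)\mapsto y\cdot t$, $t\in\mathbb R$, that is minimal ($Y\ne\emptyset$ has no nonempty proper closed invariant subset) and distal ($\inf_{t\in\mathbb R}d_Y(y_1\cdot t,y_2\cdot t)>0$ whenever $y_1\neq y_2$). Let $X$ be a real Banach space and $C\subset X$ a closed convex set with $\lambda C\subset C$ for all $\lambda>0$, $C\cap(-C)=\{0\}$ and nonempty interior. Let $\Pi(x,y,t)=(u(x,y,t),\,y\cdot t)$, $t\ge 0$, be a continuous skew-product semiflow on $X\times Y$ such that: - ($C^1$ in $x$) for $t>0$ the Fréchet derivative $u_x(x,y,t)\in\mathcal L(X)$ exists at every $(x,y)$; for each fixed $t>0$ the map $(x,y)\mapsto u_x(x,y,t)$ is continuous (in operator norm) on every compact subset of $X\times Y$; and for each $v\in X$, $u_x(x,y,t)v\to v$ as $t\to0^+$ uniformly for $(x,y)$ in compact subsets of $X\times Y$; - (strong monotonicity) $u_x(x,y,t)v\in\operatorname{Int}C$ for all $(x,y)\in X\times Y$, $t>0$ and $v\in C\setminus\{0\}$. Let $K\subset X\times Y$ be a minimal set of $\Pi$,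 i.e. a nonempty compact set with $\Pi_t(K)\subset K$ for all $t\ge0$ that contains no other nonempty compact positively invariant set, and suppose that $K$ admits a flow extension, i.e. $\Pi|_K$ extends to a continuous skew-product flow on $K$ with time $t\in\mathbb R$, again denoted $\Pi$. Assume moreover: (i) there is $\tau>0$ such that $u_x(x,y,\tau)$ is a compact operator for all $(x,y)\in\hat K=\{(sx_1+(1-s)x_2,y):(x_1,y),(x_2,y)\in K,\ s\in[0,1]\}$; (ii) $K$ is linearly stable: $\displaystyle\sup_{(x,y)\in K}\limsup_{t\to+\infty}\frac{\ln\|u_x(x,y,t)\|}{t}\le 0$. Let $$P(K)=\Big\{(k_1,k_2)\in K\times K:\ \inf_{t\in\mathbb R}d\big(\Pi(k_1,t),\Pi(k_2,t)\big)=0\Big\}$$ be the proximal relation of the flow on $K$ (with $d$ a product metric on $X\times Y$), and let $$O(K)=\{((x_1,y),(x_2,y)):\ (x_1,y),(x_2,y)\in K,\ x_1-x_2\in C\cup(-C)\}$$ be the order relation on $K$. Then (a) $P(K)$ is an equivalence relation on $K$; (b) $P(K)=O(K)$. -/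

import Mathlib

open Set Filter Topology
open scoped NNReal

noncomputable section

namespace SkewProduct

/-! ## Flows on metric spaces -/

section Flows

variable {Z : Type*} [MetricSpace Z]

/-- Two points are distal if their orbits stay a positive distance apart over all of `ℝ`. -/
def Distal (φ : Flow ℝ Z) (z₁ z₂ : Z) : Prop :=
  0 < ⨅ t : ℝ, dist (φ t z₁) (φ t z₂)

/-- Two points are proximal if they are not distal. -/
def Proximal (φ : Flow ℝ Z) (z₁ z₂ : Z) : Prop :=
  ¬ Distal φ z₁ z₂

/-- The proximal relation `P(Z)` of a flow, as a subset of `Z × Z`. -/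
def proximalRelation (φ : Flow ℝ Z) : Set (Z × Z) :=
  {q | Proximal φ q.1 q.2}

/-- A distal flow: every point is proximal only to itself. -/
def IsDistalFlow (φ : Flow ℝ Z) : Prop :=
  ∀ z₁ z₂ : Z, Proximal φ z₁ z₂ → z₂ = z₁

/-- A minimal flow (on a compact space): the phase space is nonempty and has no nonempty proper
closed invariant subset. -/
def IsMinimalFlow (φ : Flow ℝ Z) : Prop :=
  Nonempty Z ∧
    ∀ M : Set Z, IsClosed M → M.Nonempty → (∀ t : ℝ, φ t '' M = M) → M = univ

end Flows

/-! ## Strongly ordered Banach spaces -/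

section Cones

variable {X : Type*} [NormedAddCommGroup X] [NormedSpace ℝ X]

/-- `C` is a cone: closed, convex, stable under positive scaling, with `C ∩ (-C) = {0}`. -/
structure IsCone (C : Set X) : Prop where
  isClosed : IsClosed C
  convex : Convex ℝ C
  smul_mem : ∀ r : ℝ, 0 < r → ∀ v ∈ C, r • v ∈ C
  inter_neg : C ∩ -C = {0}

/-- `(X, C)` is strongly ordered: `C` is a cone with nonempty interior. -/
def IsStronglyOrdered (C : Set X) : Prop :=
  IsCone C ∧ (interior C).Nonempty

/-- A bounded operator `L` is strongly positive if `L v ≫ 0` whenever `v > 0`. -/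
def IsStronglyPositive (C : Set X) (L : X →L[ℝ] X) : Prop :=
  ∀ v ∈ C, v ≠ 0 → L v ∈ interior C

end Cones

/-! ## Skew-product semiflows

A continuous semiflow on `X × Y` is a `Flow ℝ≥0 (X × Y)`: jointly continuous in time and space,
with the identity at time `0` and the semigroup law. -/

section Semiflows

variable {X Y : Type*} [NormedAddCommGroup X] [NormedSpace ℝ X] [MetricSpace Y]

/-- `Φ` is a skew-product semiflow over `σ`, that is `Φ (x, y, t) = (u (x, y, t), y · t)`. -/
def IsSkewProduct (σ : Flow ℝ Y) (Φ : Flow ℝ≥0 (X × Y)) : Prop :=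
  ∀ (t : ℝ≥0) (x : X) (y : Y), (Φ t (x, y)).2 = σ (t : ℝ) y

/-- The fibre component `u (x, y, t)`. -/
def fiberMap (Φ : Flow ℝ≥0 (X × Y)) (x : X) (y : Y) (t : ℝ≥0) : X :=
  (Φ t (x, y)).1

/-- The derivative `u_x (x, y, t)` of `u` with respect to `x`. -/
def fiberDeriv (Φ : Flow ℝ≥0 (X × Y)) (x : X) (y : Y) (t : ℝ≥0) : X →L[ℝ] X :=
  fderiv ℝ (fun z : X => fiberMap Φ z y t) x

/-- `Φ` is of class `C¹` in `x`. -/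
structure IsC1InX (Φ : Flow ℝ≥0 (X × Y)) : Prop where
  differentiableAt : ∀ t : ℝ≥0, 0 < t → ∀ (x : X) (y : Y),
    DifferentiableAt ℝ (fun z : X => fiberMap Φ z y t) x
  continuousOn : ∀ t : ℝ≥0, 0 < t → ∀ A : Set (X × Y), IsCompact A →
    ContinuousOn (fun q : X × Y => fiberDeriv Φ q.1 q.2 t) A
  tendsto_zero : ∀ (v : X) (A : Set (X × Y)), IsCompact A →
    TendstoUniformlyOn (fun (t : ℝ≥0) (q : X × Y) => fiberDeriv Φ q.1 q.2 t v)
      (fun _ => v) (𝓝[>] 0) A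

/-- `Φ` is strongly monotone: `u_x (x, y, t)` is strongly positive for all `(x, y)`, `t > 0`. -/
def IsStronglyMonotone (C : Set X) (Φ : Flow ℝ≥0 (X × Y)) : Prop :=
  ∀ (x : X) (y : Y) (t : ℝ≥0), 0 < t → IsStronglyPositive C (fiberDeriv Φ x y t)

/-- `A` is positively invariant: `Φ_t A ⊆ A` for all `t ≥ 0`. -/
def IsPositivelyInvariant (Φ : Flow ℝ≥0 (X × Y)) (A : Set (X × Y)) : Prop :=
  ∀ t : ℝ≥0, Φ t '' A ⊆ A

/-- `K` is a minimal set of the semiflow: nonempty, compact, positively invariant, and containing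
no other nonempty compact positively invariant set. -/
structure IsMinimalSet (Φ : Flow ℝ≥0 (X × Y)) (K : Set (X × Y)) : Prop where
  nonempty : K.Nonempty
  isCompact : IsCompact K
  invariant : IsPositivelyInvariant Φ K
  minimal : ∀ A : Set (X × Y), A ⊆ K → A.Nonempty → IsCompact A →
    IsPositivelyInvariant Φ A → A = K

/-- `φ` is a flow extension on `K`: a skew-product flow on `K` agreeing with `Φ` for `t ≥ 0`. -/
structure IsFlowExtension (σ : Flow ℝ Y) (Φ : Flow ℝ≥0 (X × Y)) (K : Set (X × Y))
    (φ : Flow ℝ K) : Prop where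
  skew : ∀ (t : ℝ) (q : K), (φ t q : X × Y).2 = σ t (q : X × Y).2
  extends_semiflow : ∀ (t : ℝ≥0) (q : K), (φ (t : ℝ) q : X × Y) = Φ t (q : X × Y)

/-- The Lyapunov exponent `limsup_{t → ∞} ln ‖u_x (x, y, t)‖ / t`, an extended real
(with `ln 0 = -∞`). -/
def lyapunovExponent (Φ : Flow ℝ≥0 (X × Y)) (x : X) (y : Y) : EReal :=
  limsup (fun t : ℝ≥0 => ENNReal.log ‖fiberDeriv Φ x y t‖ₑ / ((t : ℝ) : EReal)) atTop

/-- The principal Lyapunov exponent on `K`. -/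
def principalLyapunovExponent (Φ : Flow ℝ≥0 (X × Y)) (K : Set (X × Y)) : EReal :=
  ⨆ q ∈ K, lyapunovExponent Φ q.1 q.2

/-- `K` is linearly stable. -/
def IsLinearlyStable (Φ : Flow ℝ≥0 (X × Y)) (K : Set (X × Y)) : Prop :=
  principalLyapunovExponent Φ K ≤ 0

/-- The fibrewise union `K̂` of all segments between points of `K` over the same base point. -/
def fiberHull (K : Set (X × Y)) : Set (X × Y) :=
  {q | ∃ (x₁ x₂ : X) (y : Y) (s : ℝ), (x₁, y) ∈ K ∧ (x₂, y) ∈ K ∧ s ∈ Icc (0 : ℝ) 1 ∧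
    q = (s • x₁ + (1 - s) • x₂, y)}

/-- The order relation `O(K)`: pairs in the same fibre of `K` with `x₁ - x₂ ∈ ±C`. -/
def orderRelation (C : Set X) (K : Set (X × Y)) : Set (K × K) :=
  {q | (q.1 : X × Y).2 = (q.2 : X × Y).2 ∧
    ((q.1 : X × Y).1 - (q.2 : X × Y).1 ∈ C ∨ (q.1 : X × Y).1 - (q.2 : X × Y).1 ∈ -C)}

end Semiflows

end SkewProduct

end

/-!
The order relation consists of proximal pairs, and conversely, for two separate reasons.

*Ordered pairs are proximal* (`positivelyProximal_of_sub_mem`). If the forward orbit of an ordered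
pair stayed away from the diagonal, strong monotonicity and compactness would keep it uniformly
strongly ordered. By minimality of `K`, every point of `K` would then have a point of `K` below it,
by a fixed multiple of an order unit. This is impossible at a point of `K` that minimises a
positive functional.

*Negatively proximal pairs are ordered* (`mem_orderRelation_of_negativelyProximal`). The difference
of two orbits over the same base point evolves under the averaged derivatives
`∫ u_x (θ x₁ + (1 - θ) x₂, y, τ) dθ`, which form a norm-compact family of compact, strongly
positive operators. For such a family an exponential separation holds
(`IsPositiveFamily.exponential_separation`): a vector whose orbit has not yet become comparable
with `0` is exponentially small compared to the orbit `v` of an order unit. To see this, the orbit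
`w` is enclosed as `α v ≤ w ≤ β v`. Since `β v - w` and `w - α v` are positive and add up to
`(β - α) v`, one of them is mapped far into the interior of the cone, so that `β - α` contracts. The
cone need not be normal; its role is taken over by compactness of the operators, which makes the
norm of `w` either contract or be controlled by `β - α`. A combination of both quantities decreases
geometrically. Linear stability bounds `v` by any prescribed exponential as long as the two orbits
remain close (`exists_uniform_cocycle_growth`), so unordered pairs are Lyapunov stable in forward
time (`exists_unordered_stability`), and an unordered pair cannot have been close in the past.

*Positively proximal pairs are ordered* (`mem_orderRelation_of_positivelyProximal`). This is reduced
to the negative case by topological dynamics. An idempotent `e` among the limits of the negative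
time maps fixes `p` and sends `q` to a point `q'` negatively proximal to `q`, such that `(p, q')` is
almost periodic (`exists_idempotent_fixing`). Then `q` and `q'` are ordered; a forward limit that
identifies `p` and `q` makes the images of `p` and `q'` an ordered pair, hence proximal, and almost
periodicity gives `p = q'`.

Transitivity of proximality follows in the same way: a forward limit that identifies `p` and `q`
keeps `q` and `r` ordered, and a second one identifies their images.
-/

noncomputable section

namespace SkewProduct

/-! ### Cones and positive functionals -/

section Cone

variable {X : Type*} [NormedAddCommGroup X] [NormedSpace ℝ X] {C : Set X} {e : X}

theorem IsCone.zero_mem (hC : IsCone C) : (0 : X) ∈ C := by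
  have h : (0 : X) ∈ C ∩ -C := by rw [hC.inter_neg]; rfl
  exact h.1

theorem IsCone.smul_mem_of_nonneg (hC : IsCone C) {r : ℝ} (hr : 0 ≤ r) {x : X} (hx : x ∈ C) :
    r • x ∈ C := by
  rcases hr.eq_or_lt with rfl | hr
  · simpa using hC.zero_mem
  · exact hC.smul_mem r hr x hx

theorem IsCone.add_mem (hC : IsCone C) {x y : X} (hx : x ∈ C) (hy : y ∈ C) : x + y ∈ C := by
  have h := hC.smul_mem 2 two_pos _
    (hC.convex hx hy (by norm_num : (0 : ℝ) ≤ 1 / 2) (by norm_num : (0 : ℝ) ≤ 1 / 2) (by norm_num))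
  convert h using 1
  rw [smul_add, smul_smul, smul_smul]
  norm_num

theorem IsCone.eq_zero (hC : IsCone C) {x : X} (hx : x ∈ C) (hx' : -x ∈ C) : x = 0 := by
  have h : x ∈ C ∩ -C := ⟨hx, hx'⟩
  rwa [hC.inter_neg] at h

/-- An interior point of the cone is an order unit, quantitatively in the norm. -/
theorem IsCone.exists_orderUnit_bound (hC : IsCone C) (he : e ∈ interior C) :
    ∃ b : ℝ, 0 < b ∧ ∀ x : X, (b * ‖x‖) • e + x ∈ C := by
  obtain ⟨ρ, hρ, hball⟩ := Metric.isOpen_iff.1 isOpen_interior e he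
  refine ⟨2 / ρ, by positivity, fun x => ?_⟩
  rcases eq_or_ne x 0 with rfl | hx
  · simpa using hC.zero_mem
  have hx' : 0 < ‖x‖ := norm_pos_iff.2 hx
  have hm : e + (ρ / (2 * ‖x‖)) • x ∈ C := by
    apply interior_subset
    apply hball
    rw [Metric.mem_ball, dist_eq_norm, add_sub_cancel_left, norm_smul, Real.norm_of_nonneg
      (by positivity)]
    field_simp
    linarith
  have := hC.smul_mem (2 / ρ * ‖x‖) (by positivity) _ hm
  convert this using 1
  rw [smul_add, smul_smul]
  congr 1
  rw [show 2 / ρ * ‖x‖ * (ρ / (2 * ‖x‖)) = 1 by field_simp, one_smul]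

theorem IsCone.add_mem_interior (hC : IsCone C) {x y : X} (hx : x ∈ interior C) (hy : y ∈ C) :
    x + y ∈ interior C := by
  have h : (fun z => z + y) '' interior C ⊆ interior C := by
    apply interior_maximal
    · rintro _ ⟨z, hz, rfl⟩
      exact hC.add_mem (interior_subset hz) hy
    · exact (Homeomorph.addRight y).isOpenMap _ isOpen_interior
  exact h ⟨x, hx, rfl⟩

theorem IsCone.smul_mem_interior (hC : IsCone C) {r : ℝ} (hr : 0 < r) {x : X}
    (hx : x ∈ interior C) : r • x ∈ interior C := by
  have h : (fun z => r • z) '' interior C ⊆ interior C := by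
    apply interior_maximal
    · rintro _ ⟨z, hz, rfl⟩
      exact hC.smul_mem r hr z (interior_subset hz)
    · exact (Homeomorph.smulOfNeZero r hr.ne').isOpenMap _ isOpen_interior
  exact h ⟨x, hx, rfl⟩

theorem IsCone.mem_interior_of_sub_mem (hC : IsCone C) (he : e ∈ interior C) {δ : ℝ} (hδ : 0 < δ)
    {x : X} (hx : x - δ • e ∈ C) : x ∈ interior C := by
  have h := hC.add_mem_interior (hC.smul_mem_interior hδ he) hx
  rwa [add_sub_cancel] at h

/-- A compact subset of the interior of the cone dominates a fixed positive multiple of any given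
vector. -/
theorem exists_forall_sub_smul_mem {S : Set X} (hS : IsCompact S) (hSC : S ⊆ interior C) (e : X) :
    ∃ δ : ℝ, 0 < δ ∧ ∀ x ∈ S, x - δ • e ∈ C := by
  obtain ⟨ρ, hρ, h⟩ := hS.exists_thickening_subset_open isOpen_interior hSC
  refine ⟨ρ / (‖e‖ + 1), by positivity, fun x hx => interior_subset (h ?_)⟩
  rw [Metric.mem_thickening_iff]
  refine ⟨x, hx, ?_⟩
  rw [dist_eq_norm, sub_sub_cancel_left, norm_neg, norm_smul, Real.norm_of_nonneg (by positivity),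
    div_mul_eq_mul_div, div_lt_iff₀ (by positivity)]
  nlinarith [norm_nonneg e]

/-- A functional that is nonnegative on the cone is controlled in norm by its value at an order
unit. -/
theorem apply_le_of_nonneg {b : ℝ} (hb : ∀ x : X, (b * ‖x‖) • e + x ∈ C) {f : X →L[ℝ] ℝ}
    (hf : ∀ x ∈ C, 0 ≤ f x) (x : X) : f x ≤ b * ‖x‖ * f e := by
  have h := hf _ (hb (-x))
  simp only [map_add, map_smul, map_neg, smul_eq_mul, norm_neg] at h
  linarith

/-- If the cone is not the whole space, it carries a nonnegative functional that is positive at the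
interior point `e`. -/
theorem IsCone.exists_positive_functional (hC : IsCone C) (he : e ∈ interior C) {w : X}
    (hw : w ∉ C) : ∃ f : X →L[ℝ] ℝ, (∀ x ∈ C, 0 ≤ f x) ∧ 0 < f e := by
  obtain ⟨f, u, hfw, hfu⟩ := geometric_hahn_banach_point_closed hC.convex hC.isClosed hw
  have hu : u < 0 := by simpa using hfu 0 hC.zero_mem
  have hf : ∀ x ∈ C, 0 ≤ f x := by
    intro x hx
    by_contra! hneg
    have h := hfu _ (hC.smul_mem (u / f x) (div_pos_of_neg_of_neg hu hneg) x hx)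
    rw [map_smul, smul_eq_mul, div_mul_cancel₀ _ hneg.ne] at h
    exact lt_irrefl _ h
  refine ⟨f, hf, ?_⟩
  obtain ⟨b, hb, hbx⟩ := hC.exists_orderUnit_bound he
  have h := apply_le_of_nonneg hbx hf (-w)
  rw [map_neg, norm_neg] at h
  have h1 : 0 < b * ‖w‖ * f e := by linarith
  have h2 : 0 ≤ b * ‖w‖ := by positivity
  exact pos_of_mul_pos_right h1 h2

end Cone

/-! ### Compact families of compact, strongly positive operators -/

section Family

variable {X : Type*} [NormedAddCommGroup X] [NormedSpace ℝ X]
  {C : Set X} {e : X} {𝓛 : Set (X →L[ℝ] X)}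

/-- A norm-compact family of compact operators is collectively compact. -/
theorem isCompact_closure_image2_apply [CompleteSpace X] (h𝓛 : IsCompact 𝓛)
    (hcomp : ∀ L ∈ 𝓛, IsCompactOperator L) (R : ℝ) :
    IsCompact (closure (image2 (fun (L : X →L[ℝ] X) x => L x) 𝓛 (Metric.closedBall 0 R))) := by
  apply TotallyBounded.isCompact_of_isClosed _ isClosed_closure
  apply TotallyBounded.closure
  rw [Metric.totallyBounded_iff]
  intro ε hε
  obtain ⟨t, ht𝓛, htf, htc⟩ := h𝓛.finite_cover_balls
    (show (0 : ℝ) < ε / (2 * (|R| + 1)) by positivity)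
  have htb : TotallyBounded (⋃ L ∈ t, (fun x => L x) '' Metric.closedBall (0 : X) R) :=
    (totallyBounded_biUnion htf).2 fun L hL =>
      (((hcomp L (ht𝓛 hL)).isCompact_closure_image_closedBall (f := (L : X →ₗ[ℝ] X))
        R).totallyBounded).subset subset_closure
  obtain ⟨s, hs, hsc⟩ := Metric.totallyBounded_iff.1 htb (ε / 2) (by positivity)
  refine ⟨s, hs, ?_⟩
  rintro _ ⟨L, hL, x, hx, rfl⟩
  obtain ⟨L', hL', hd⟩ := mem_iUnion₂.1 (htc hL)
  have hx' : L' x ∈ ⋃ L ∈ t, (fun x => L x) '' Metric.closedBall (0 : X) R :=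
    mem_iUnion₂.2 ⟨L', hL', x, hx, rfl⟩
  obtain ⟨y, hy, hyd⟩ := mem_iUnion₂.1 (hsc hx')
  refine mem_iUnion₂.2 ⟨y, hy, ?_⟩
  rw [Metric.mem_ball] at hyd hd ⊢
  have h1 : dist (L x) (L' x) ≤ ε / 2 := by
    rw [dist_eq_norm, ← sub_apply]
    refine ((L - L').le_opNorm x).trans ?_
    rw [← dist_eq_norm]
    have hxR : ‖x‖ ≤ |R| + 1 := by
      have := mem_closedBall_zero_iff.1 hx
      linarith [le_abs_self R]
    calc dist L L' * ‖x‖ ≤ ε / (2 * (|R| + 1)) * (|R| + 1) := by gcongr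
      _ = ε / 2 := by field_simp
  calc dist (L x) y ≤ dist (L x) (L' x) + dist (L' x) y := dist_triangle _ _ _
    _ < ε := by linarith

/-- Two successive operators of the family map positive vectors uniformly into the interior of the
cone, as long as the first one does not shrink them too much. -/
theorem exists_uniform_positivity [CompleteSpace X] (hC : IsCone C) (e : X) (h𝓛 : IsCompact 𝓛)
    (hcomp : ∀ L ∈ 𝓛, IsCompactOperator L) (hpos : ∀ L ∈ 𝓛, IsStronglyPositive C L)
    (R : ℝ) {c : ℝ} (hc : 0 < c) :
    ∃ δ : ℝ, 0 < δ ∧ ∀ L ∈ 𝓛, ∀ L' ∈ 𝓛, ∀ r ∈ C, ‖r‖ ≤ R → c ≤ ‖L r‖ →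
      L' (L r) - δ • e ∈ C := by
  set W := closure (image2 (fun (L : X →L[ℝ] X) x => L x) 𝓛 (Metric.closedBall 0 R))
  set W' := W ∩ (C ∩ {x | c ≤ ‖x‖})
  have hW' : IsCompact W' := (isCompact_closure_image2_apply h𝓛 hcomp R).inter_right
    (hC.isClosed.inter (isClosed_le continuous_const continuous_norm))
  have himg : IsCompact ((fun p : (X →L[ℝ] X) × X => p.1 p.2) '' (𝓛 ×ˢ W')) :=
    (h𝓛.prod hW').image isBoundedBilinearMap_apply.continuous
  obtain ⟨δ, hδ, h⟩ := exists_forall_sub_smul_mem (C := C) himg (by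
    rintro _ ⟨⟨L, x⟩, ⟨hL, hx⟩, rfl⟩
    refine hpos L hL x hx.2.1 fun h0 => ?_
    have : c ≤ ‖x‖ := hx.2.2
    rw [h0, norm_zero] at this
    linarith) e
  refine ⟨δ, hδ, fun L hL L' hL' r hr hrR hcr => h _ ⟨(L', L r), ⟨hL', ?_, ?_, hcr⟩, rfl⟩⟩
  · exact subset_closure ⟨L, hL, r, mem_closedBall_zero_iff.2 hrR, rfl⟩
  · by_cases h0 : r = 0
    · simpa [h0] using hC.zero_mem
    · exact interior_subset (hpos L hL r hr h0)

/-- A substitute for normality of the cone: on images under the family, smallness in order forces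
smallness in norm. -/
theorem exists_not_order_small [CompleteSpace X] (hC : IsCone C) (e : X) (h𝓛 : IsCompact 𝓛)
    (hcomp : ∀ L ∈ 𝓛, IsCompactOperator L) (R : ℝ) {c : ℝ} (hc : 0 < c) :
    ∃ ε : ℝ, 0 < ε ∧ ∀ L ∈ 𝓛, ∀ r : X, ‖r‖ ≤ R → c ≤ ‖L r‖ →
      ¬ (ε • e - L r ∈ C ∧ ε • e + L r ∈ C) := by
  by_contra! hcon
  set W := closure (image2 (fun (L : X →L[ℝ] X) x => L x) 𝓛 (Metric.closedBall 0 R))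
  have hW : IsCompact W := isCompact_closure_image2_apply h𝓛 hcomp R
  choose L hL r hr hcr h1 h2 using fun n : ℕ => hcon (1 / ((n : ℝ) + 1)) (by positivity)
  obtain ⟨x, -, g, hg, hx⟩ := hW.tendsto_subseq (x := fun n => L n (r n))
    fun n => subset_closure ⟨L n, hL n, r n, mem_closedBall_zero_iff.2 (hr n), rfl⟩
  have hε : Tendsto (fun n => (1 / ((g n : ℝ) + 1)) • e) atTop (𝓝 ((0 : ℝ) • e)) :=
    ((tendsto_one_div_add_atTop_nhds_zero_nat (𝕜 := ℝ)).comp hg.tendsto_atTop).smul_const e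
  rw [zero_smul] at hε
  have hx1 : x ∈ C := by
    have := hC.isClosed.mem_of_tendsto (hε.add hx) (Eventually.of_forall fun n => h2 (g n))
    simpa using this
  have hx2 : -x ∈ C := by
    have := hC.isClosed.mem_of_tendsto (hε.sub hx) (Eventually.of_forall fun n => h1 (g n))
    simpa using this
  have hxc : c ≤ ‖x‖ := ge_of_tendsto hx.norm (Eventually.of_forall fun n => hcr (g n))
  rw [hC.eq_zero hx1 hx2, norm_zero] at hxc
  linarith

theorem exists_opNorm_bound (h𝓛 : IsCompact 𝓛) : ∃ B : ℝ, 0 < B ∧ ∀ L ∈ 𝓛, ‖L‖ ≤ B := by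
  obtain ⟨B, hB, h⟩ := h𝓛.isBounded.exists_pos_norm_le
  exact ⟨B, hB, h⟩

theorem exists_forall_apply_sub_mem (he : e ∈ interior C) (he0 : e ≠ 0)
    (h𝓛 : IsCompact 𝓛) (hpos : ∀ L ∈ 𝓛, IsStronglyPositive C L) :
    ∃ δ : ℝ, 0 < δ ∧ ∀ L ∈ 𝓛, L e - δ • e ∈ C := by
  obtain ⟨δ, hδ, h⟩ := exists_forall_sub_smul_mem (C := C)
    (h𝓛.image (ContinuousLinearMap.apply ℝ X e).continuous) (by
      rintro _ ⟨L, hL, rfl⟩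
      exact hpos L hL e (interior_subset he) he0) e
  exact ⟨δ, hδ, fun L hL => h _ ⟨L, hL, rfl⟩⟩

end Family

/-! ### Exponential separation -/

section Separation

variable {X : Type*} [NormedAddCommGroup X] [NormedSpace ℝ X]
  {C : Set X} {e : X} {𝓛 : Set (X →L[ℝ] X)}

theorem IsStronglyPositive.apply_mem {L : X →L[ℝ] X} (hL : IsStronglyPositive C L) (hC : IsCone C)
    {v : X} (hv : v ∈ C) : L v ∈ C := by
  by_cases h0 : v = 0
  · simpa [h0] using hC.zero_mem
  · exact interior_subset (hL v hv h0)

/-- A norm-compact family `𝓛` of compact, strongly positive operators for the cone `C`, together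
with a nonzero interior point `e` of `C` used as order unit. -/
structure IsPositiveFamily (C : Set X) (e : X) (𝓛 : Set (X →L[ℝ] X)) : Prop where
  isCone : IsCone C
  mem_interior : e ∈ interior C
  ne_zero : e ≠ 0
  isCompact : IsCompact 𝓛
  isCompactOperator : ∀ L ∈ 𝓛, IsCompactOperator L
  isStronglyPositive : ∀ L ∈ 𝓛, IsStronglyPositive C L

/-- One-step norm control for positive vectors: measured against the pulled back functional, the
norm of a positive vector can only grow up to a fixed multiple of the value of the functional. -/
theorem IsPositiveFamily.exists_norm_apply_le [CompleteSpace X] (h : IsPositiveFamily C e 𝓛) :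
    ∃ A : ℝ, 0 < A ∧ ∀ L ∈ 𝓛, ∀ L' ∈ 𝓛, ∀ ψ : X →L[ℝ] ℝ, (∀ x ∈ C, 0 ≤ ψ x) → ∀ v ∈ C,
      ‖L v‖ * ψ (L' e) ≤ max (‖v‖ * ψ (L' (L e))) (A * ψ (L' (L v))) := by
  obtain ⟨b, hb, hbx⟩ := h.isCone.exists_orderUnit_bound h.mem_interior
  obtain ⟨B, hB, hBL⟩ := exists_opNorm_bound h.isCompact
  obtain ⟨δ₁, hδ₁, hδ₁L⟩ := exists_forall_apply_sub_mem h.mem_interior h.ne_zero h.isCompact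
    h.isStronglyPositive
  obtain ⟨δ, hδ, hUP⟩ := exists_uniform_positivity h.isCone e h.isCompact h.isCompactOperator
    h.isStronglyPositive 1 hδ₁
  have he : 0 < ‖e‖ := norm_pos_iff.2 h.ne_zero
  refine ⟨B * (b * (B * ‖e‖)) / δ, by positivity, fun L hL L' hL' ψ hψ v hv => ?_⟩
  have heC : e ∈ C := interior_subset h.mem_interior
  have hL'C : ∀ {x}, x ∈ C → L' x ∈ C := fun hx =>
    (h.isStronglyPositive L' hL').apply_mem h.isCone hx
  -- if `L` does not shrink `v`, the next operator moves `L v` uniformly into the interior,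
  -- where the functional controls the norm
  by_cases hcase : ‖L v‖ ≤ δ₁ * ‖v‖
  · refine le_max_of_le_left ?_
    have h1 := hψ _ (hL'C (hδ₁L L hL))
    simp only [map_sub, map_smul, smul_eq_mul] at h1
    have h2 : 0 ≤ ψ (L' e) := hψ _ (hL'C heC)
    calc ‖L v‖ * ψ (L' e) ≤ δ₁ * ‖v‖ * ψ (L' e) := by gcongr
      _ = ‖v‖ * (δ₁ * ψ (L' e)) := by ring
      _ ≤ ‖v‖ * ψ (L' (L e)) := by gcongr; linarith
  · refine le_max_of_le_right ?_
    push Not at hcase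
    have hv0 : 0 < ‖v‖ := by
      rcases (norm_nonneg v).eq_or_lt with h0 | h0
      · rw [norm_eq_zero.1 h0.symm] at hcase
        simp at hcase
      · exact h0
    have hup := hUP L hL L' hL' (‖v‖⁻¹ • v) (h.isCone.smul_mem _ (inv_pos.2 hv0) v hv)
      (by rw [norm_smul, norm_inv, norm_norm, inv_mul_cancel₀ hv0.ne'])
      (by
        rw [map_smul, norm_smul, norm_inv, norm_norm, inv_mul_eq_div, le_div_iff₀ hv0]
        exact hcase.le)
    have h1 := hψ _ hup
    simp only [map_sub, map_smul, smul_eq_mul] at h1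
    have h2 : δ * ‖v‖ * ψ e ≤ ψ (L' (L v)) := by
      rw [inv_mul_eq_div, sub_nonneg, le_div_iff₀ hv0] at h1
      linarith
    have hψe : 0 ≤ ψ e := hψ e heC
    have h3 : ψ (L' e) ≤ b * (B * ‖e‖) * ψ e := by
      refine (apply_le_of_nonneg hbx hψ (L' e)).trans ?_
      gcongr
      exact L'.le_of_opNorm_le (hBL L' hL') e
    have h4 : ‖L v‖ ≤ B * ‖v‖ := L.le_of_opNorm_le (hBL L hL) v
    calc ‖L v‖ * ψ (L' e) ≤ B * ‖v‖ * (b * (B * ‖e‖) * ψ e) := by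
          gcongr
          exact hψ _ (hL'C heC)
      _ = B * (b * (B * ‖e‖)) / δ * (δ * ‖v‖ * ψ e) := by field_simp
      _ ≤ _ := by gcongr

/-- One-step norm control for arbitrary vectors: either the norm contracts by a prescribed factor,
or it is controlled by an order bound. -/
theorem IsPositiveFamily.exists_norm_le_orderBound [CompleteSpace X]
    (h : IsPositiveFamily C e 𝓛) {c : ℝ} (hc : 0 < c) :
    ∃ A : ℝ, 0 < A ∧ ∀ L ∈ 𝓛, ∀ w : X, ∀ a : ℝ, 0 ≤ a → a • e - w ∈ C → a • e + w ∈ C →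
      ‖L w‖ ≤ c * ‖w‖ ∨ ‖L w‖ ≤ A * a := by
  obtain ⟨b, hb, hbx⟩ := h.isCone.exists_orderUnit_bound h.mem_interior
  obtain ⟨B, hB, hBL⟩ := exists_opNorm_bound h.isCompact
  obtain ⟨ε, hε, hLN⟩ := exists_not_order_small h.isCone e h.isCompact h.isCompactOperator 1 hc
  have he : 0 < ‖e‖ := norm_pos_iff.2 h.ne_zero
  refine ⟨B * (b * (B * ‖e‖)) / ε, by positivity, fun L hL w a ha h1 h2 => ?_⟩
  by_contra! hcon
  obtain ⟨hcase, hbig⟩ := hcon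
  have hw0 : 0 < ‖w‖ := by
    rcases (norm_nonneg w).eq_or_lt with h0 | h0
    · rw [norm_eq_zero.1 h0.symm] at hcase
      simp at hcase
    · exact h0
  have hLe : (b * (B * ‖e‖)) • e - L e ∈ C := by
    have h3 := hbx (-(L e))
    rw [norm_neg, ← sub_eq_add_neg] at h3
    have h4 : L e ∈ C := (h.isStronglyPositive L hL).apply_mem h.isCone
      (interior_subset h.mem_interior)
    have h5 := L.le_of_opNorm_le (hBL L hL) e
    have h6 := h.isCone.smul_mem_of_nonneg (r := b * (B * ‖e‖) - b * ‖L e‖)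
      (by rw [← mul_sub]; exact mul_nonneg hb.le (sub_nonneg.2 h5))
      (interior_subset h.mem_interior)
    convert h.isCone.add_mem h3 h6 using 1
    rw [sub_smul]
    abel
  -- the order bound of `L w`, in units of `‖w‖`, is below `ε` because `‖L w‖` is large
  have hsmall : b * (B * ‖e‖) * a < ε * ‖w‖ := by
    have h4 : ‖L w‖ ≤ B * ‖w‖ := L.le_of_opNorm_le (hBL L hL) w
    have h5 := hbig.trans_le h4
    rw [div_mul_eq_mul_div, div_lt_iff₀ hε] at h5
    have h6 : B * (b * (B * ‖e‖) * a) < B * (ε * ‖w‖) := by linarith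
    exact lt_of_mul_lt_mul_left h6 hB.le
  have key : ∀ x : X, a • e - x ∈ C → ε • e - ‖w‖⁻¹ • L x ∈ C := by
    intro x hx
    have h3 := (h.isStronglyPositive L hL).apply_mem h.isCone hx
    have h4 := h.isCone.smul_mem_of_nonneg ha hLe
    have h5 := h.isCone.smul_mem_of_nonneg (r := ε * ‖w‖ - b * (B * ‖e‖) * a) (by linarith)
      (interior_subset h.mem_interior)
    have h6 := h.isCone.smul_mem_of_nonneg (inv_nonneg.2 hw0.le)
      (h.isCone.add_mem (h.isCone.add_mem h3 h4) h5)
    convert h6 using 1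
    rw [map_sub, map_smul]
    have h7 : ε • e = ‖w‖⁻¹ • ((ε * ‖w‖) • e) := by
      rw [smul_smul]
      congr 1
      field_simp
    rw [h7, ← smul_sub]
    congr 1
    rw [smul_sub, smul_smul, sub_smul, mul_comm a]
    abel
  refine hLN L hL (‖w‖⁻¹ • w) (by rw [norm_smul, norm_inv, norm_norm, inv_mul_cancel₀ hw0.ne'])
    ?_ ⟨?_, ?_⟩
  · rw [map_smul, norm_smul, norm_inv, norm_norm, inv_mul_eq_div, le_div_iff₀ hw0]
    exact hcase.le
  · rw [map_smul]
    exact key w h1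
  · have := key (-w) (by rwa [sub_neg_eq_add])
    rw [map_neg, smul_neg, sub_neg_eq_add] at this
    rwa [map_smul]

/-- If two positive vectors of controlled norm add up to something substantial, then one of them is
mapped by two successive operators uniformly into the interior of the cone. -/
theorem IsPositiveFamily.exists_splitting_bound [CompleteSpace X] (h : IsPositiveFamily C e 𝓛)
    (R : ℝ) :
    ∃ δ : ℝ, 0 < δ ∧ ∀ L ∈ 𝓛, ∀ L' ∈ 𝓛, ∀ ψ : X →L[ℝ] ℝ, (∀ x ∈ C, 0 ≤ ψ x) → 0 < ψ e →
      ∀ r ∈ C, ∀ r' ∈ C, ∀ s : ℝ, 0 < s → ‖r‖ ≤ R * s → ‖r'‖ ≤ R * s →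
        s * ψ (L e) ≤ ψ (L (r + r')) →
          L' (L r) - (δ * s) • e ∈ C ∨ L' (L r') - (δ * s) • e ∈ C := by
  obtain ⟨b, hb, hbx⟩ := h.isCone.exists_orderUnit_bound h.mem_interior
  obtain ⟨δ₁, hδ₁, hδ₁L⟩ := exists_forall_apply_sub_mem h.mem_interior h.ne_zero h.isCompact
    h.isStronglyPositive
  obtain ⟨δ, hδ, hUP⟩ := exists_uniform_positivity h.isCone e h.isCompact h.isCompactOperator
    h.isStronglyPositive R (c := δ₁ / (2 * b)) (by positivity)
  refine ⟨δ, hδ, fun L hL L' hL' ψ hψ hψe r hr r' hr' s hs hrR hrR' hsum => ?_⟩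
  have key : ∀ x ∈ C, ‖x‖ ≤ R * s → s * ψ (L e) / 2 ≤ ψ (L x) →
      L' (L x) - (δ * s) • e ∈ C := by
    intro x hx hxR hxψ
    have h1 := hψ _ (hδ₁L L hL)
    simp only [map_sub, map_smul, smul_eq_mul] at h1
    have h2 := apply_le_of_nonneg hbx hψ (L x)
    have h3 : s * (δ₁ * ψ e) / 2 ≤ b * ‖L x‖ * ψ e := by
      have : s * (δ₁ * ψ e) ≤ s * ψ (L e) := by gcongr; linarith
      linarith
    have h4 : s * δ₁ / 2 ≤ b * ‖L x‖ := by
      refine le_of_mul_le_mul_right ?_ hψe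
      linarith
    have hup := hUP L hL L' hL' (s⁻¹ • x) (h.isCone.smul_mem _ (inv_pos.2 hs) x hx)
      (by
        rw [norm_smul, norm_inv, Real.norm_of_nonneg hs.le, inv_mul_eq_div, div_le_iff₀ hs]
        exact hxR)
      (by
        rw [map_smul, norm_smul, norm_inv, Real.norm_of_nonneg hs.le, inv_mul_eq_div,
          div_le_div_iff₀ (by positivity) hs]
        linarith)
    have h5 := h.isCone.smul_mem s hs _ hup
    convert h5 using 1
    rw [map_smul, map_smul, smul_sub, smul_smul, mul_inv_cancel₀ hs.ne', one_smul, smul_smul,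
      mul_comm s]
  rw [map_add, map_add] at hsum
  rcases le_total (s * ψ (L e) / 2) (ψ (L r)) with h1 | h1
  · exact Or.inl (key r hr hrR h1)
  · exact Or.inr (key r' hr' hrR' (by linarith))

/-- Pulling a functional back along a sequence of operators, from time `n + 1` down to `0`. -/
theorem exists_pullback (L : ℕ → X →L[ℝ] X)
    (hL : ∀ i, ∀ x ∈ C, L i x ∈ C) (hLe : ∀ i, ∃ δ : ℝ, 0 < δ ∧ L i e - δ • e ∈ C)
    (f : X →L[ℝ] ℝ) (hf : ∀ x ∈ C, 0 ≤ f x) (hfe : 0 < f e) (n : ℕ) :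
    ∃ ψ : ℕ → X →L[ℝ] ℝ, (∀ j ≤ n, ∀ x, ψ j x = ψ (j + 1) (L j x)) ∧
      ∀ j, (∀ x ∈ C, 0 ≤ ψ j x) ∧ 0 < ψ j e := by
  let g : ℕ → X →L[ℝ] ℝ := fun k => Nat.rec f (fun k gk => gk.comp (L (n - k))) k
  have hg : ∀ k, (∀ x ∈ C, 0 ≤ g k x) ∧ 0 < g k e := by
    intro k
    induction k with
    | zero => exact ⟨hf, hfe⟩
    | succ k ih =>
      refine ⟨fun x hx => ih.1 _ (hL _ x hx), ?_⟩
      obtain ⟨δ, hδ, hd⟩ := hLe (n - k)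
      have h1 := ih.1 _ hd
      rw [map_sub, map_smul, smul_eq_mul] at h1
      have h2 : 0 < δ * g k e := mul_pos hδ ih.2
      change 0 < g k (L (n - k) e)
      linarith
  refine ⟨fun j => g (n + 1 - j), fun j hj x => ?_, fun j => hg _⟩
  have h1 : n + 1 - j = (n - j) + 1 := by omega
  have h2 : n + 1 - (j + 1) = n - j := by omega
  have h3 : n - (n - j) = j := by omega
  change g (n + 1 - j) x = g (n + 1 - (j + 1)) (L j x)
  rw [h1, h2]
  change g (n - j) (L (n - (n - j)) x) = _
  rw [h3]

/-- The scale `s j = ψ 0 e / ψ j e` along the positive orbit `v` issuing from `e`: it bounds the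
norm of `v j` up to a constant, is itself bounded by `‖v n‖` at the final time, and changes by bounded
factors in each step. The functionals `ψ j` are obtained by pulling back one positive functional
from time `n + 1`, one step beyond `n` because norm control at time `j` uses the operator `L j`. -/
theorem IsPositiveFamily.exists_scale [CompleteSpace X] (h : IsPositiveFamily C e 𝓛) :
    ∃ δ A c : ℝ, 0 < δ ∧ 0 < A ∧ 0 < c ∧ ∀ L : ℕ → X →L[ℝ] X, (∀ i, L i ∈ 𝓛) →
      ∀ v : ℕ → X, v 0 = e → (∀ i, v (i + 1) = L i (v i)) → ∀ n : ℕ, (∃ w : X, w ∉ C) →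
      ∃ (s : ℕ → ℝ) (ψ : ℕ → X →L[ℝ] ℝ), (∀ j, 0 < s j) ∧ s 0 = 1 ∧
        (∀ j < n, δ * s j ≤ s (j + 1) ∧ s (j + 1) ≤ c * s j) ∧ (∀ j ≤ n, ‖v j‖ ≤ A * s j) ∧
        s n ≤ c * ‖v n‖ ∧ (∀ j, (∀ x ∈ C, 0 ≤ ψ j x) ∧ 0 < ψ j e) ∧
        ∀ j ≤ n, s j * ψ (j + 1) (L j e) ≤ ψ (j + 1) (L j (v j)) := by
  obtain ⟨b, hb, hbx⟩ := h.isCone.exists_orderUnit_bound h.mem_interior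
  obtain ⟨B, hB, hBL⟩ := exists_opNorm_bound h.isCompact
  obtain ⟨δ, hδ, hδL⟩ := exists_forall_apply_sub_mem h.mem_interior h.ne_zero h.isCompact
    h.isStronglyPositive
  obtain ⟨A, hA, hAL⟩ := h.exists_norm_apply_le
  have he : 0 < ‖e‖ := norm_pos_iff.2 h.ne_zero
  refine ⟨δ, max ‖e‖ A, max b (b * (B * ‖e‖)), hδ, lt_max_of_lt_right hA, lt_max_of_lt_left hb,
    fun L hL v hv0 hv n ⟨w, hw⟩ => ?_⟩
  obtain ⟨f, hf, hfe⟩ := h.isCone.exists_positive_functional h.mem_interior hw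
  obtain ⟨ψ, hψL, hψ⟩ := exists_pullback (C := C) (e := e) L
    (fun i x hx => (h.isStronglyPositive _ (hL i)).apply_mem h.isCone hx)
    (fun i => ⟨δ, hδ, hδL _ (hL i)⟩) f hf hfe n
  have hvC : ∀ j, v j ∈ C := by
    intro j
    induction j with
    | zero => rw [hv0]; exact interior_subset h.mem_interior
    | succ j ih => rw [hv]; exact (h.isStronglyPositive _ (hL j)).apply_mem h.isCone ih
  have hψv : ∀ j ≤ n + 1, ψ j (v j) = ψ 0 e := by
    intro j
    induction j with
    | zero => intro _; rw [hv0]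
    | succ j ih => intro hj; rw [hv, ← hψL j (by omega)]; exact ih (by omega)
  have hE : ∀ j, 0 < ψ j e := fun j => (hψ j).2
  have hlow : ∀ j ≤ n, δ * ψ (j + 1) e ≤ ψ j e := by
    intro j hj
    have := (hψ (j + 1)).1 _ (hδL _ (hL j))
    rw [map_sub, map_smul, smul_eq_mul, ← hψL j hj] at this
    linarith
  have hupp : ∀ j ≤ n, ψ j e ≤ b * (B * ‖e‖) * ψ (j + 1) e := by
    intro j hj
    rw [hψL j hj]
    refine (apply_le_of_nonneg hbx (hψ (j + 1)).1 _).trans ?_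
    have := (L j).le_of_opNorm_le (hBL _ (hL j)) e
    have := (hE (j + 1)).le
    gcongr
  have hnorm : ∀ j ≤ n, ‖v j‖ * ψ j e ≤ max ‖e‖ A * ψ 0 e := by
    intro j
    induction j with
    | zero =>
      intro _
      rw [hv0]
      exact mul_le_mul_of_nonneg_right (le_max_left _ _) (hE 0).le
    | succ j ih =>
      intro hj
      have h1 := hAL (L j) (hL j) (L (j + 1)) (hL (j + 1)) (ψ (j + 2)) (hψ (j + 2)).1 (v j) (hvC j)
      rw [← hψL (j + 1) hj, ← hψL (j + 1) hj, ← hψL (j + 1) hj, ← hψL j (by omega),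
        ← hψL j (by omega), hψv j (by omega), ← hv] at h1
      refine h1.trans (max_le (ih (by omega)) ?_)
      exact mul_le_mul_of_nonneg_right (le_max_right _ _) (hE 0).le
  refine ⟨fun j => ψ 0 e / ψ j e, ψ, fun j => div_pos (hE 0) (hE j), div_self (hE 0).ne',
    fun j hj => ⟨?_, ?_⟩, fun j hj => ?_, ?_, hψ, fun j hj => ?_⟩
  · rw [le_div_iff₀ (hE _), mul_div_assoc', div_mul_eq_mul_div, div_le_iff₀ (hE _)]
    have := hlow j hj.le
    have := mul_le_mul_of_nonneg_left this (hE 0).le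
    linarith
  · rw [div_le_iff₀ (hE _), mul_div_assoc', div_mul_eq_mul_div, le_div_iff₀ (hE _)]
    have h1 := (hupp j hj.le).trans
      (mul_le_mul_of_nonneg_right (le_max_right b _) (hE (j + 1)).le)
    have := mul_le_mul_of_nonneg_left h1 (hE 0).le
    linarith
  · rw [mul_div_assoc', le_div_iff₀ (hE _)]
    exact hnorm j hj
  · rw [div_le_iff₀ (hE _), ← hψv n (by omega)]
    refine (apply_le_of_nonneg hbx (hψ n).1 _).trans ?_
    have := (hE n).le
    gcongr
    exact le_max_left _ _
  · rw [← hψL j hj, ← hψL j hj, hψv j (by omega), div_mul_cancel₀ _ (hE j).ne']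

theorem IsCone.smul_sub_smul_mem (hC : IsCone C) (heC : e ∈ C) {v : X} {m β q : ℝ} (hm : 0 ≤ m)
    (hv : m • e - v ∈ C) (hβ : 0 ≤ β) (hβq : β ≤ q) : (q * m) • e - β • v ∈ C := by
  have h := hC.add_mem (hC.smul_mem_of_nonneg (mul_nonneg (sub_nonneg.2 hβq) hm) heC)
    (hC.smul_mem_of_nonneg hβ hv)
  convert h using 1
  rw [smul_sub, smul_smul, sub_mul, sub_smul]
  abel

/-- The scalar inequality behind the decay of `q + ε y`, where `q` stands for the oscillation and
`y` for the rescaled norm. If `y` is not much larger than `q`, the gain is in `q`; otherwise the gain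
`y / 4` in the norm outweighs `q`. -/
theorem separation_arith {μ A ε η q q' y y' : ℝ} (hA : 0 < A) (hε : 0 < ε)
    (hε' : 2 * (ε * (A + 1)) = μ) (hη1 : η ≤ μ / 2) (hη2 : η ≤ ε / 4) (hη3 : η ≤ 1 / 4)
    (hq : 0 ≤ q) (hy : 0 ≤ y) (hy' : y' ≤ A * q + y / 4)
    (h : (y ≤ 4 * (A + 1) * q ∧ q' ≤ (1 - μ) * q) ∨ (4 * (A + 1) * q ≤ y ∧ q' ≤ q)) :
    q' + ε * y' ≤ (1 - η) * (q + ε * y) := by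
  have h0 : ε * y' ≤ ε * (A * q + y / 4) := by gcongr
  have h1 : η * (ε * y) ≤ 1 / 4 * (ε * y) := by gcongr
  have hεy : 0 ≤ ε * y := by positivity
  rcases h with ⟨-, h2⟩ | ⟨h2, h3⟩
  · have h4 : η * q ≤ μ / 2 * q := by gcongr
    have h5 : 0 ≤ ε * q := by positivity
    rw [← hε'] at h2 h4
    nlinarith
  · have h4 : η * q ≤ ε / 4 * q := by gcongr
    have h5 : ε * (4 * (A + 1) * q) ≤ ε * y := by gcongr
    have h6 : 0 ≤ ε * q := by positivity
    have h7 : 0 ≤ ε * (A * q) := by positivity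
    nlinarith

/-- **Exponential separation.** Along products of operators from a compact family of compact,
strongly positive operators, an orbit that is still not comparable with `0` at time `n` is
exponentially small compared to the orbit of the order unit. The proof contracts the combination
`(β - α) + ε ‖w‖ / s` of the oscillation of `w` relative to `v` (where `α v ≤ w ≤ β v`) and of the
rescaled norm. -/
theorem IsPositiveFamily.exponential_separation [CompleteSpace X] (h : IsPositiveFamily C e 𝓛) :
    ∃ c θ : ℝ, 0 < c ∧ 0 < θ ∧ θ < 1 ∧ ∀ L : ℕ → X →L[ℝ] X, (∀ i, L i ∈ 𝓛) →
      ∀ v w : ℕ → X, v 0 = e → (∀ i, v (i + 1) = L i (v i)) → (∀ i, w (i + 1) = L i (w i)) →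
      ∀ n : ℕ, w n ∉ C → -w n ∉ C → ‖w n‖ ≤ c * θ ^ (n / 2) * ‖v n‖ * ‖w 0‖ := by
  obtain ⟨b, hb, hbx⟩ := h.isCone.exists_orderUnit_bound h.mem_interior
  obtain ⟨δ₁, A, c, hδ₁, hA, hc, hscale⟩ := h.exists_scale
  obtain ⟨A', hA', hW⟩ := h.exists_norm_le_orderBound (half_pos hδ₁)
  obtain ⟨A₁, hA₁⟩ : ∃ A₁, A₁ = A' * (b * A) / δ₁ := ⟨_, rfl⟩
  have hA₁0 : 0 < A₁ := by rw [hA₁]; positivity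
  obtain ⟨δ, hδ, hsplit⟩ := h.exists_splitting_bound (A + 4 * (A₁ + 1))
  obtain ⟨μ, hμ⟩ : ∃ μ, μ = δ / (b * A * c ^ 2) := ⟨_, rfl⟩
  have hμ0 : 0 < μ := by rw [hμ]; positivity
  obtain ⟨ε, hε⟩ : ∃ ε, ε = μ / (2 * (A₁ + 1)) := ⟨_, rfl⟩
  have hε0 : 0 < ε := by rw [hε]; positivity
  have hεμ : 2 * (ε * (A₁ + 1)) = μ := by rw [hε]; field_simp
  obtain ⟨η, hη⟩ : ∃ η, η = min (μ / 2) (min (ε / 4) (1 / 4)) := ⟨_, rfl⟩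
  have hη0 : 0 < η := by rw [hη]; positivity
  have hη1 : η ≤ μ / 2 := by rw [hη]; exact min_le_left _ _
  have hη2 : η ≤ ε / 4 := by rw [hη]; exact (min_le_right _ _).trans (min_le_left _ _)
  have hη3 : η ≤ 1 / 4 := by rw [hη]; exact (min_le_right _ _).trans (min_le_right _ _)
  refine ⟨(1 + ε * A₁) * (2 * b + ε) * c / ε, 1 - η, by positivity, by linarith, by linarith,
    fun L hL v w hv0 hv hw n hwn hwn' => ?_⟩
  obtain ⟨s, ψ, hs, hs0, hss, hvs, hsn, hψ, hψs⟩ := hscale L hL v hv0 hv n ⟨_, hwn⟩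
  have hC := h.isCone
  have heC : e ∈ C := interior_subset h.mem_interior
  have hLC : ∀ i, ∀ x ∈ C, L i x ∈ C := fun i x hx =>
    (h.isStronglyPositive _ (hL i)).apply_mem hC hx
  have hvC : ∀ j, v j ∈ C := by
    intro j
    induction j with
    | zero => rw [hv0]; exact heC
    | succ j ih => rw [hv]; exact hLC j _ ih
  have hcone : ∀ j, w j ∈ C → ∀ k, w (j + k) ∈ C := by
    intro j hj k
    induction k with
    | zero => exact hj
    | succ k ih => rw [← add_assoc, hw]; exact hLC _ _ ih
  have hcone' : ∀ j, -w j ∈ C → ∀ k, -w (j + k) ∈ C := by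
    intro j hj k
    induction k with
    | zero => exact hj
    | succ k ih => rw [← add_assoc, hw, ← map_neg]; exact hLC _ _ ih
  have hwj : ∀ j ≤ n, w j ∉ C ∧ -w j ∉ C := by
    intro j hj
    refine ⟨fun hmem => hwn ?_, fun hmem => hwn' ?_⟩
    · have := hcone j hmem (n - j)
      rwa [Nat.add_sub_cancel' hj] at this
    · have := hcone' j hmem (n - j)
      rwa [Nat.add_sub_cancel' hj] at this
  have hve : ∀ j ≤ n, (b * A * s j) • e - v j ∈ C := by
    intro j hj
    have h1 := hbx (-(v j))
    rw [norm_neg, ← sub_eq_add_neg] at h1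
    have h2 := hC.smul_mem_of_nonneg (r := b * A * s j - b * ‖v j‖)
      (by rw [mul_assoc, ← mul_sub]; exact mul_nonneg hb.le (sub_nonneg.2 (hvs j hj))) heC
    convert hC.add_mem h1 h2 using 1
    rw [sub_smul]
    abel
  -- incomparability forces the order bounds of `w` relative to `v` to have opposite signs
  have hsign : ∀ j ≤ n, ∀ α β : ℝ, w j - α • v j ∈ C → β • v j - w j ∈ C → α ≤ 0 ∧ 0 ≤ β := by
    intro j hj α β h1 h2
    constructor
    · by_contra! hcon
      apply (hwj j hj).1
      have := hC.add_mem h1 (hC.smul_mem_of_nonneg hcon.le (hvC j))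
      rwa [sub_add_cancel] at this
    · by_contra! hcon
      apply (hwj j hj).2
      have := hC.add_mem h2 (hC.smul_mem_of_nonneg (neg_nonneg.2 hcon.le) (hvC j))
      convert this using 1
      rw [neg_smul]
      abel
  have hstep : ∀ j < n, ∀ α β : ℝ, w j - α • v j ∈ C → β • v j - w j ∈ C →
      w (j + 1) - α • v (j + 1) ∈ C ∧ β • v (j + 1) - w (j + 1) ∈ C := by
    intro j _ α β h1 h2
    have h1' := hLC j _ h1
    have h2' := hLC j _ h2
    rw [map_sub, map_smul, ← hv, ← hw] at h1' h2'
    exact ⟨h1', h2'⟩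
  have hnorm : ∀ j < n, ∀ α β y : ℝ, w j - α • v j ∈ C → β • v j - w j ∈ C →
      ‖w j‖ ≤ y * s j → ‖w (j + 1)‖ ≤ max (A₁ * (β - α)) (y / 2) * s (j + 1) := by
    intro j hj α β y h1 h2 hy
    obtain ⟨hα, hβ⟩ := hsign j hj.le α β h1 h2
    have hm : 0 ≤ b * A * s j := by have := hs j; positivity
    have h3 := hC.smul_sub_smul_mem heC hm (hve j hj.le) hβ (by linarith : β ≤ β - α)
    have h4 := hC.smul_sub_smul_mem heC hm (hve j hj.le) (neg_nonneg.2 hα)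
      (by linarith : -α ≤ β - α)
    have h5 := hW (L j) (hL j) (w j) ((β - α) * (b * A * s j))
      (mul_nonneg (by linarith) hm)
      (by convert hC.add_mem h3 h2 using 1; abel)
      (by convert hC.add_mem h4 h1 using 1; rw [neg_smul]; abel)
    rw [← hw] at h5
    have hsj := (hss j hj).1
    rcases h5 with h5 | h5
    · have hy0 : 0 ≤ y := by
        by_contra! hcon
        have := mul_neg_of_neg_of_pos hcon (hs j)
        linarith [norm_nonneg (w j)]
      calc ‖w (j + 1)‖ ≤ δ₁ / 2 * (y * s j) := h5.trans (by gcongr)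
        _ = y / 2 * (δ₁ * s j) := by ring
        _ ≤ y / 2 * s (j + 1) := by gcongr
        _ ≤ _ := mul_le_mul_of_nonneg_right (le_max_right _ _) (hs _).le
    · have hq : 0 ≤ β - α := by linarith
      calc ‖w (j + 1)‖ ≤ A₁ * (β - α) * (δ₁ * s j) := by
            refine h5.trans (le_of_eq ?_)
            rw [hA₁]
            field_simp
        _ ≤ A₁ * (β - α) * s (j + 1) := by gcongr
        _ ≤ _ := mul_le_mul_of_nonneg_right (le_max_left _ _) (hs _).le
  -- the Lyapunov functional: oscillation plus a small multiple of the rescaled norm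
  let T : ℕ → ℝ → Prop := fun j Q => ∃ α β y : ℝ, w j - α • v j ∈ C ∧ β • v j - w j ∈ C ∧
    ‖w j‖ ≤ y * s j ∧ 0 ≤ y ∧ β - α + ε * y ≤ Q
  have hone : ∀ j < n, ∀ Q, T j Q → T (j + 1) ((1 + ε * A₁) * Q) := by
    rintro j hj Q ⟨α, β, y, h1, h2, hy, hy0, hQ⟩
    obtain ⟨hα, hβ⟩ := hsign j hj.le α β h1 h2
    obtain ⟨h3, h4⟩ := hstep j hj α β h1 h2
    refine ⟨α, β, _, h3, h4, hnorm j hj α β y h1 h2 hy, le_max_of_le_right (by positivity), ?_⟩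
    have hq : 0 ≤ β - α := by linarith
    have h5 : max (A₁ * (β - α)) (y / 2) ≤ A₁ * (β - α) + y / 2 :=
      max_le (by linarith) (by linarith [mul_nonneg hA₁0.le hq])
    have h6 : ε * max (A₁ * (β - α)) (y / 2) ≤ ε * (A₁ * (β - α) + y / 2) := by gcongr
    have h7 : (1 + ε * A₁) * (β - α + ε * y) ≤ (1 + ε * A₁) * Q := by gcongr
    have h8 : 0 ≤ ε * A₁ * (ε * y) := by positivity
    have h9 : 0 ≤ ε * y := by positivity
    linarith
  have hosc : ∀ j, j + 2 ≤ n → ∀ α β y : ℝ, w j - α • v j ∈ C → β • v j - w j ∈ C →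
      ‖w j‖ ≤ y * s j → y ≤ 4 * (A₁ + 1) * (β - α) → ∃ α' β' : ℝ,
        w (j + 2) - α' • v (j + 2) ∈ C ∧ β' • v (j + 2) - w (j + 2) ∈ C ∧
          β' - α' ≤ (1 - μ) * (β - α) := by
    intro j hj α β y h1 h2 hy hyq
    obtain ⟨hα, hβ⟩ := hsign j (by omega) α β h1 h2
    have hq : 0 < β - α := by
      refine lt_of_le_of_ne (by linarith) fun h0 => (hwj j (by omega)).1 ?_
      have : α = 0 := by linarith
      simpa [this] using h1
    have hsj := hs j
    have hwR : ‖w j‖ ≤ 4 * (A₁ + 1) * (β - α) * s j := hy.trans (by gcongr)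
    have hvR := hvs j (by omega)
    have hr1 : ‖β • v j - w j‖ ≤ (A + 4 * (A₁ + 1)) * ((β - α) * s j) := by
      have h3 : ‖β • v j‖ ≤ (β - α) * (A * s j) := by
        rw [norm_smul, Real.norm_of_nonneg hβ]
        gcongr
        linarith
      refine (norm_sub_le _ _).trans ?_
      linarith
    have hr2 : ‖w j - α • v j‖ ≤ (A + 4 * (A₁ + 1)) * ((β - α) * s j) := by
      have h3 : ‖α • v j‖ ≤ (β - α) * (A * s j) := by
        rw [norm_smul, Real.norm_of_nonpos hα]
        gcongr
        linarith
      refine (norm_sub_le _ _).trans ?_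
      linarith
    have h3 := hsplit (L j) (hL j) (L (j + 1)) (hL (j + 1)) (ψ (j + 1)) (hψ _).1 (hψ _).2
      _ h2 _ h1 ((β - α) * s j) (by positivity) hr1 hr2 (by
        have h4 : β • v j - w j + (w j - α • v j) = (β - α) • v j := by
          rw [sub_smul]; abel
        rw [h4, map_smul, map_smul, smul_eq_mul, mul_assoc]
        exact mul_le_mul_of_nonneg_left (hψs j (by omega)) hq.le)
    have hgain : (δ * ((β - α) * s j)) • e - (μ * (β - α)) • v (j + 2) ∈ C := by
      have hs2 : s (j + 2) ≤ c ^ 2 * s j := by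
        have h4 := (hss (j + 1) (by omega)).2
        have h5 := (hss j (by omega)).2
        calc s (j + 2) ≤ c * (c * s j) := h4.trans (by gcongr)
          _ = c ^ 2 * s j := by ring
      have h4 := hC.smul_sub_smul_mem heC (by have := hs (j + 2); positivity) (hve (j + 2) hj)
        (mul_nonneg hμ0.le hq.le) le_rfl
      have h5 : μ * (β - α) * (b * A * s (j + 2)) ≤ δ * ((β - α) * s j) := by
        calc μ * (β - α) * (b * A * s (j + 2)) ≤ μ * (β - α) * (b * A * (c ^ 2 * s j)) := by gcongr
          _ = δ * ((β - α) * s j) := by rw [hμ]; field_simp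
      have h6 := hC.add_mem h4 (hC.smul_mem_of_nonneg (sub_nonneg.2 h5) heC)
      convert h6 using 1
      rw [sub_smul]
      abel
    obtain ⟨h4, h5⟩ := hstep j (by omega) α β h1 h2
    obtain ⟨h6, h7⟩ := hstep (j + 1) (by omega) α β h4 h5
    have hLLw : L (j + 1) (L j (w j)) = w (j + 2) := by rw [← hw, ← hw]
    have hLLv : L (j + 1) (L j (v j)) = v (j + 2) := by rw [← hv, ← hv]
    rcases h3 with h3 | h3
    · refine ⟨α, β - μ * (β - α), h6, ?_, by linarith⟩
      have h8 := hC.add_mem h3 hgain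
      simp only [map_sub, map_smul, hLLw, hLLv] at h8
      convert h8 using 1
      rw [sub_smul]
      abel
    · refine ⟨α + μ * (β - α), β, ?_, h7, by linarith⟩
      have h8 := hC.add_mem h3 hgain
      simp only [map_sub, map_smul, hLLw, hLLv] at h8
      convert h8 using 1
      rw [add_smul]
      abel
  have htwo : ∀ j, j + 2 ≤ n → ∀ Q, T j Q → T (j + 2) ((1 - η) * Q) := by
    rintro j hj Q ⟨α, β, y, h1, h2, hy, hy0, hQ⟩
    obtain ⟨hα, hβ⟩ := hsign j (by omega) α β h1 h2
    have hq : 0 ≤ β - α := by linarith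
    obtain ⟨h3, h4⟩ := hstep j (by omega) α β h1 h2
    obtain ⟨h5, h6⟩ := hstep (j + 1) (by omega) α β h3 h4
    have hn1 := hnorm j (by omega) α β y h1 h2 hy
    have hn2 := hnorm (j + 1) (by omega) α β _ h3 h4 hn1
    have hAq : 0 ≤ A₁ * (β - α) := by positivity
    have hy'0 : 0 ≤ max (A₁ * (β - α)) (max (A₁ * (β - α)) (y / 2) / 2) := le_max_of_le_left hAq
    have hy' : max (A₁ * (β - α)) (max (A₁ * (β - α)) (y / 2) / 2) ≤ A₁ * (β - α) + y / 4 := by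
      refine max_le (by linarith) ?_
      have : max (A₁ * (β - α)) (y / 2) ≤ 2 * (A₁ * (β - α) + y / 4) :=
        max_le (by linarith) (by linarith)
      linarith
    have hQ' : (1 - η) * (β - α + ε * y) ≤ (1 - η) * Q := by
      have : 0 ≤ 1 - η := by linarith
      gcongr
    rcases le_total y (4 * (A₁ + 1) * (β - α)) with hcase | hcase
    · obtain ⟨α', β', h7, h8, h9⟩ := hosc j hj α β y h1 h2 hy hcase
      exact ⟨α', β', _, h7, h8, hn2, hy'0, (separation_arith hA₁0 hε0 hεμ hη1 hη2 hη3 hq hy0 hy'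
        (Or.inl ⟨hcase, h9⟩)).trans hQ'⟩
    · exact ⟨α, β, _, h5, h6, hn2, hy'0, (separation_arith hA₁0 hε0 hεμ hη1 hη2 hη3 hq hy0 hy'
        (Or.inr ⟨hcase, le_rfl⟩)).trans hQ'⟩
  have hzero : T 0 ((2 * b + ε) * ‖w 0‖) := by
    refine ⟨-(b * ‖w 0‖), b * ‖w 0‖, ‖w 0‖, ?_, ?_, by rw [hs0, mul_one], norm_nonneg _, by
      linarith⟩
    · have := hbx (w 0)
      rw [hv0, neg_smul, sub_neg_eq_add, add_comm]
      exact this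
    · have := hbx (-(w 0))
      rw [hv0, sub_eq_add_neg]
      rwa [norm_neg] at this
  have heven : ∀ i, 2 * i ≤ n → T (2 * i) ((1 - η) ^ i * ((2 * b + ε) * ‖w 0‖)) := by
    intro i
    induction i with
    | zero => intro _; simpa using hzero
    | succ i ih =>
      intro hi
      have := htwo (2 * i) (by omega) _ (ih (by omega))
      rwa [← mul_assoc, ← pow_succ'] at this
  have hT : T n ((1 + ε * A₁) * ((1 - η) ^ (n / 2) * ((2 * b + ε) * ‖w 0‖))) := by
    have h1 := heven (n / 2) (by omega)
    rcases Nat.mod_two_eq_zero_or_one n with h2 | h2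
    · have h3 : 2 * (n / 2) = n := by omega
      rw [h3] at h1
      obtain ⟨α, β, y, h4, h5, h6, h7, h8⟩ := h1
      refine ⟨α, β, y, h4, h5, h6, h7, h8.trans ?_⟩
      have h9 : 0 ≤ (1 - η) ^ (n / 2) * ((2 * b + ε) * ‖w 0‖) := by
        have : 0 ≤ 1 - η := by linarith
        positivity
      have h10 : 0 ≤ ε * A₁ := by positivity
      exact le_mul_of_one_le_left h9 (by linarith)
    · have h3 : 2 * (n / 2) + 1 = n := by omega
      have := hone (2 * (n / 2)) (by omega) _ h1
      rwa [h3] at this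
  obtain ⟨α, β, y, h1, h2, hy, hy0, hQ⟩ := hT
  obtain ⟨hα, hβ⟩ := hsign n le_rfl α β h1 h2
  have h3 : ε * y ≤ (1 + ε * A₁) * ((1 - η) ^ (n / 2) * ((2 * b + ε) * ‖w 0‖)) := by linarith
  calc ‖w n‖ ≤ y * (c * ‖v n‖) := hy.trans (by gcongr)
    _ = ε * y * (c * ‖v n‖) / ε := by field_simp
    _ ≤ (1 + ε * A₁) * ((1 - η) ^ (n / 2) * ((2 * b + ε) * ‖w 0‖)) * (c * ‖v n‖) / ε := by gcongr
    _ = _ := by ring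

end Separation

/-! ### Averaged derivatives along segments -/

section SegmentOperator

variable {X Y : Type*} [NormedAddCommGroup X] [NormedSpace ℝ X] [MetricSpace Y]
  {C : Set X} {σ : Flow ℝ Y} {Φ : Flow ℝ≥0 (X × Y)} {t : ℝ≥0}

/-- Continuity on compact sets is continuity, because `X × Y` is metrizable. -/
theorem IsC1InX.continuous_fiberDeriv (hC1 : IsC1InX Φ) (ht : 0 < t) :
    Continuous fun q : X × Y => fiberDeriv Φ q.1 q.2 t := by
  rw [continuous_iff_seqContinuous]
  intro u q hu
  have hc := hC1.continuousOn t ht _ hu.isCompact_insert_range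
  exact (hc q (mem_insert _ _)).tendsto.comp (tendsto_nhdsWithin_iff.2
    ⟨hu, Eventually.of_forall fun n => mem_insert_of_mem _ (mem_range_self n)⟩)

/-- The derivative of `u (·, y, t)`, averaged over the segment from `x₂` to `x₁`. It maps
`x₁ - x₂` to `u (x₁, y, t) - u (x₂, y, t)`. -/
def segmentOperator (Φ : Flow ℝ≥0 (X × Y)) (t : ℝ≥0) (x₁ x₂ : X) (y : Y) : X →L[ℝ] X :=
  ∫ θ in (0 : ℝ)..1, fiberDeriv Φ (θ • x₁ + (1 - θ) • x₂) y t

theorem IsC1InX.continuous_segment (hC1 : IsC1InX Φ) (ht : 0 < t) (x₁ x₂ : X) (y : Y) :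
    Continuous fun θ : ℝ => fiberDeriv Φ (θ • x₁ + (1 - θ) • x₂) y t :=
  (hC1.continuous_fiberDeriv ht).comp
    (by fun_prop : Continuous fun θ : ℝ => (θ • x₁ + (1 - θ) • x₂, y))

theorem IsC1InX.continuous_segmentOperator (hC1 : IsC1InX Φ) (ht : 0 < t) :
    Continuous fun p : (X × X) × Y => segmentOperator Φ t p.1.1 p.1.2 p.2 := by
  refine intervalIntegral.continuous_parametric_intervalIntegral_of_continuous' ?_ 0 1
  exact (hC1.continuous_fiberDeriv ht).comp (by fun_prop :
    Continuous fun p : ((X × X) × Y) × ℝ => (p.2 • p.1.1.1 + (1 - p.2) • p.1.1.2, p.1.2))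

theorem segmentOperator_self [CompleteSpace X] (x : X) (y : Y) :
    segmentOperator Φ t x x y = fiberDeriv Φ x y t := by
  have h : ∀ θ : ℝ, θ • x + (1 - θ) • x = x := fun θ => by rw [← add_smul]; simp
  simp [segmentOperator, h]

theorem IsC1InX.segmentOperator_apply [CompleteSpace X] (hC1 : IsC1InX Φ) (ht : 0 < t)
    (x₁ x₂ : X) (y : Y) (v : X) :
    segmentOperator Φ t x₁ x₂ y v
      = ∫ θ in (0 : ℝ)..1, fiberDeriv Φ (θ • x₁ + (1 - θ) • x₂) y t v :=
  ContinuousLinearMap.intervalIntegral_apply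
    ((hC1.continuous_segment ht x₁ x₂ y).intervalIntegrable 0 1) v

theorem IsC1InX.segmentOperator_apply_sub [CompleteSpace X] (hC1 : IsC1InX Φ) (ht : 0 < t)
    (x₁ x₂ : X) (y : Y) :
    segmentOperator Φ t x₁ x₂ y (x₁ - x₂) = fiberMap Φ x₁ y t - fiberMap Φ x₂ y t := by
  rw [hC1.segmentOperator_apply ht]
  have hd : ∀ θ ∈ uIcc (0 : ℝ) 1, HasDerivAt (fun θ : ℝ => fiberMap Φ (θ • x₁ + (1 - θ) • x₂) y t)
      (fiberDeriv Φ (θ • x₁ + (1 - θ) • x₂) y t (x₁ - x₂)) θ := by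
    intro θ _
    have h1 : HasDerivAt (fun θ : ℝ => θ • x₁ + (1 - θ) • x₂) (x₁ - x₂) θ := by
      have h2 := ((hasDerivAt_id θ).smul_const x₁).add
        (((hasDerivAt_id θ).const_sub 1).smul_const x₂)
      have h3 : (1 : ℝ) • x₁ + (-1 : ℝ) • x₂ = x₁ - x₂ := by
        rw [one_smul, neg_one_smul, sub_eq_add_neg]
      rw [h3] at h2
      exact h2
    exact (hC1.differentiableAt t ht _ y).hasFDerivAt.comp_hasDerivAt θ h1
  rw [intervalIntegral.integral_eq_sub_of_hasDerivAt hd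
    (((hC1.continuous_segment ht x₁ x₂ y).clm_apply continuous_const).intervalIntegrable 0 1)]
  simp

theorem segment_integral_mem {E : Type*} [NormedAddCommGroup E] [NormedSpace ℝ E] [CompleteSpace E]
    {S : Set E} (hS : Convex ℝ S) (hS' : IsClosed S) {f : ℝ → E} (hf : Continuous f)
    (hfS : ∀ θ ∈ Icc (0 : ℝ) 1, f θ ∈ S) : ∫ θ in (0 : ℝ)..1, f θ ∈ S := by
  rw [intervalIntegral.integral_of_le zero_le_one]
  have : MeasureTheory.IsProbabilityMeasure (MeasureTheory.volume.restrict (Ioc (0 : ℝ) 1)) :=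
    ⟨by simp⟩
  refine hS.integral_mem hS' ?_ ?_
  · rw [MeasureTheory.ae_restrict_iff' measurableSet_Ioc]
    exact Eventually.of_forall fun θ hθ => hfS θ ⟨hθ.1.le, hθ.2⟩
  · exact (hf.intervalIntegrable 0 1).1

theorem segmentOperator_isStronglyPositive [CompleteSpace X] (hC : IsCone C)
    (hC1 : IsC1InX Φ) (hmono : IsStronglyMonotone C Φ) (ht : 0 < t) (x₁ x₂ : X) (y : Y) :
    IsStronglyPositive C (segmentOperator Φ t x₁ x₂ y) := by
  intro v hv hv0
  have hcont : Continuous fun θ : ℝ => fiberDeriv Φ (θ • x₁ + (1 - θ) • x₂) y t v :=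
    (hC1.continuous_segment ht x₁ x₂ y).clm_apply continuous_const
  have hint : ∀ θ : ℝ, fiberDeriv Φ (θ • x₁ + (1 - θ) • x₂) y t v ∈ interior C :=
    fun θ => hmono _ _ t ht v hv hv0
  -- a uniform lower bound along the segment survives integration
  obtain ⟨δ, hδ, h⟩ := exists_forall_sub_smul_mem (C := C)
    ((isCompact_Icc (a := (0 : ℝ)) (b := 1)).image hcont)
    (by rintro _ ⟨θ, -, rfl⟩; exact hint θ) _
  refine hC.mem_interior_of_sub_mem (hint 0) hδ ?_
  have hI := segment_integral_mem hC.convex hC.isClosed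
    (hcont.sub (continuous_const (y := δ • fiberDeriv Φ ((0 : ℝ) • x₁ + (1 - (0 : ℝ)) • x₂) y t v)))
    fun θ hθ => h _ ⟨θ, hθ, rfl⟩
  simp only [Pi.sub_apply] at hI
  rw [intervalIntegral.integral_sub (hcont.intervalIntegrable 0 1)
    (continuous_const.intervalIntegrable 0 1), ← hC1.segmentOperator_apply ht] at hI
  simpa using hI

theorem segmentOperator_isCompactOperator [CompleteSpace X] (hC1 : IsC1InX Φ) (ht : 0 < t)
    {x₁ x₂ : X} {y : Y}
    (h : ∀ θ ∈ Icc (0 : ℝ) 1, IsCompactOperator (fiberDeriv Φ (θ • x₁ + (1 - θ) • x₂) y t)) :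
    IsCompactOperator (segmentOperator Φ t x₁ x₂ y) := by
  have hconv : Convex ℝ {L : X →L[ℝ] X | IsCompactOperator L} := by
    intro L hL L' hL' a b _ _ _
    exact (hL.smul a).add (hL'.smul b)
  exact segment_integral_mem hconv isClosed_setOfPred_isCompactOperator
    (hC1.continuous_segment ht x₁ x₂ y) h

/-- Strict order is turned into strong order by the semiflow. -/
theorem fiberMap_sub_mem_interior [CompleteSpace X] (hC : IsCone C)
    (hC1 : IsC1InX Φ) (hmono : IsStronglyMonotone C Φ) (ht : 0 < t) {x₁ x₂ : X} (y : Y)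
    (h : x₁ - x₂ ∈ C) (hne : x₁ - x₂ ≠ 0) :
    fiberMap Φ x₁ y t - fiberMap Φ x₂ y t ∈ interior C := by
  rw [← hC1.segmentOperator_apply_sub ht]
  exact segmentOperator_isStronglyPositive hC hC1 hmono ht _ _ _ _ h hne

/-- The chain rule: `u_x` is a cocycle over the semiflow. -/
theorem fiberDeriv_add (hskew : IsSkewProduct σ Φ) (hC1 : IsC1InX Φ) {s : ℝ≥0} (ht : 0 < t)
    (hs : 0 < s) (x : X) (y : Y) :
    fiberDeriv Φ x y (t + s)
      = (fiberDeriv Φ (Φ s (x, y)).1 (Φ s (x, y)).2 t).comp (fiberDeriv Φ x y s) := by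
  have h : (fun z => fiberMap Φ z y (t + s))
      = (fun z => fiberMap Φ z (Φ s (x, y)).2 t) ∘ fun z => fiberMap Φ z y s := by
    funext z
    simp only [fiberMap, Function.comp_apply, Φ.map_add]
    rw [hskew s x y, ← hskew s z y]
  unfold fiberDeriv
  rw [h, fderiv_comp _ (hC1.differentiableAt t ht _ _) (hC1.differentiableAt s hs _ _)]
  rfl

end SegmentOperator

/-! ### Ordered pairs are positively proximal -/

section Proximality

variable {Z : Type*} [MetricSpace Z]

theorem proximal_iff {φ : Flow ℝ Z} {p q : Z} :
    Proximal φ p q ↔ ∀ ε : ℝ, 0 < ε → ∃ t : ℝ, dist (φ t p) (φ t q) < ε := by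
  have hbdd : BddBelow (range fun t : ℝ => dist (φ t p) (φ t q)) :=
    ⟨0, by rintro _ ⟨t, rfl⟩; exact dist_nonneg⟩
  constructor
  · intro h ε hε
    by_contra! hcon
    exact h (hε.trans_le (le_ciInf hcon))
  · intro h hd
    obtain ⟨t, ht⟩ := h _ hd
    exact absurd (ciInf_le hbdd t) (not_le.2 ht)

/-- The orbits of `p` and `q` come arbitrarily close to each other in positive time. -/
def PositivelyProximal (φ : Flow ℝ Z) (p q : Z) : Prop :=
  ∀ ε : ℝ, 0 < ε → ∃ t : ℝ, 0 ≤ t ∧ dist (φ t p) (φ t q) < ε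

/-- The orbits of `p` and `q` come arbitrarily close to each other in negative time. -/
def NegativelyProximal (φ : Flow ℝ Z) (p q : Z) : Prop :=
  ∀ ε : ℝ, 0 < ε → ∃ t : ℝ, t ≤ 0 ∧ dist (φ t p) (φ t q) < ε

theorem PositivelyProximal.symm {φ : Flow ℝ Z} {p q : Z}
    (h : PositivelyProximal φ p q) : PositivelyProximal φ q p := fun ε hε =>
  (h ε hε).imp fun _ ht => ⟨ht.1, by rw [dist_comm]; exact ht.2⟩

theorem PositivelyProximal.proximal {φ : Flow ℝ Z} {p q : Z} (h : PositivelyProximal φ p q) :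
    Proximal φ p q :=
  proximal_iff.2 fun ε hε => (h ε hε).imp fun _ ht => ht.2

theorem NegativelyProximal.proximal {φ : Flow ℝ Z} {p q : Z} (h : NegativelyProximal φ p q) :
    Proximal φ p q :=
  proximal_iff.2 fun ε hε => (h ε hε).imp fun _ ht => ht.2

theorem Proximal.positively_or_negatively {φ : Flow ℝ Z} {p q : Z} (h : Proximal φ p q) :
    PositivelyProximal φ p q ∨ NegativelyProximal φ p q := by
  by_contra! hcon
  obtain ⟨h1, h2⟩ := hcon
  simp only [PositivelyProximal, NegativelyProximal] at h1 h2
  push Not at h1 h2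
  obtain ⟨ε₁, hε₁, h1⟩ := h1
  obtain ⟨ε₂, hε₂, h2⟩ := h2
  obtain ⟨t, ht⟩ := proximal_iff.1 h (min ε₁ ε₂) (lt_min hε₁ hε₂)
  rcases le_total 0 t with h0 | h0
  · exact absurd (h1 t h0) (not_le.2 (ht.trans_le (min_le_left _ _)))
  · exact absurd (h2 t h0) (not_le.2 (ht.trans_le (min_le_right _ _)))

end Proximality

section FlowExtension

variable {X Y : Type*} [NormedAddCommGroup X] [MetricSpace Y]
  {σ : Flow ℝ Y} {Φ : Flow ℝ≥0 (X × Y)} {K : Set (X × Y)} {φ : Flow ℝ K}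

theorem IsFlowExtension.fst_eq (hφ : IsFlowExtension σ Φ K φ) {t : ℝ} (ht : 0 ≤ t) (q : K) :
    (φ t q : X × Y).1 = fiberMap Φ (q : X × Y).1 (q : X × Y).2 ⟨t, ht⟩ :=
  congrArg Prod.fst (hφ.extends_semiflow ⟨t, ht⟩ q)

theorem IsFlowExtension.snd_eq_snd (hφ : IsFlowExtension σ Φ K φ) (t : ℝ) {p q : K}
    (h : (p : X × Y).2 = (q : X × Y).2) : (φ t p : X × Y).2 = (φ t q : X × Y).2 := by
  rw [hφ.skew, hφ.skew, h]

/-- Proximal points lie over the same base point, because the base flow is distal. -/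
theorem IsFlowExtension.snd_eq_of_proximal (hφ : IsFlowExtension σ Φ K φ)
    (hσ : IsDistalFlow σ) {p q : K} (h : Proximal φ p q) : (p : X × Y).2 = (q : X × Y).2 := by
  refine (hσ _ _ (proximal_iff.2 fun ε hε => ?_)).symm
  obtain ⟨t, ht⟩ := proximal_iff.1 h ε hε
  refine ⟨t, lt_of_le_of_lt ?_ ht⟩
  rw [← hφ.skew, ← hφ.skew]
  exact le_max_right _ _

theorem dist_eq_norm_sub_of_snd_eq {p q : K} (h : (p : X × Y).2 = (q : X × Y).2) :
    dist p q = ‖(p : X × Y).1 - (q : X × Y).1‖ := by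
  rw [Subtype.dist_eq, Prod.dist_eq, h, dist_self, dist_eq_norm]
  exact max_eq_left (norm_nonneg _)

/-- Minimality of `K`, restated for the flow on the subtype `K`. -/
theorem IsMinimalSet.eq_univ_of_isClosed (hK : IsMinimalSet Φ K) (hφ : IsFlowExtension σ Φ K φ)
    {A : Set K} (hA : IsClosed A) (hne : A.Nonempty)
    (hinv : ∀ t : ℝ, 0 ≤ t → ∀ q ∈ A, φ t q ∈ A) : A = univ := by
  have : CompactSpace K := isCompact_iff_compactSpace.1 hK.isCompact
  have h : Subtype.val '' A = K := by
    refine hK.minimal _ (by rintro _ ⟨q, -, rfl⟩; exact q.2) (hne.image _)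
      (hA.isCompact.image continuous_subtype_val) ?_
    rintro t _ ⟨_, ⟨q, hq, rfl⟩, rfl⟩
    exact ⟨φ t q, hinv t t.2 q hq, hφ.extends_semiflow t q⟩
  refine eq_univ_of_forall fun q => ?_
  have hq : (q : X × Y) ∈ Subtype.val '' A := by rw [h]; exact q.2
  obtain ⟨q', hq', he⟩ := hq
  rwa [← Subtype.ext he]

end FlowExtension

section OrderedPairs

variable {X Y : Type*} [NormedAddCommGroup X] [NormedSpace ℝ X] [MetricSpace Y]
  {C : Set X} {σ : Flow ℝ Y} {Φ : Flow ℝ≥0 (X × Y)} {K : Set (X × Y)} {φ : Flow ℝ K}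

theorem IsFlowExtension.sub_mem_interior [CompleteSpace X] (hφ : IsFlowExtension σ Φ K φ)
    (hC : IsCone C) (hC1 : IsC1InX Φ) (hmono : IsStronglyMonotone C Φ) {t : ℝ} (ht : 0 < t)
    {p q : K} (hpq : (p : X × Y).2 = (q : X × Y).2) (h : (p : X × Y).1 - (q : X × Y).1 ∈ C)
    (hne : p ≠ q) : (φ t p : X × Y).1 - (φ t q : X × Y).1 ∈ interior C := by
  rw [hφ.fst_eq ht.le, hφ.fst_eq ht.le, ← hpq]
  refine fiberMap_sub_mem_interior hC hC1 hmono (by exact_mod_cast ht) _ h fun h0 => hne ?_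
  exact Subtype.ext (Prod.ext (sub_eq_zero.1 h0) hpq)

theorem IsFlowExtension.sub_mem [CompleteSpace X] (hφ : IsFlowExtension σ Φ K φ)
    (hC : IsCone C) (hC1 : IsC1InX Φ) (hmono : IsStronglyMonotone C Φ) {t : ℝ} (ht : 0 ≤ t)
    {p q : K} (hpq : (p : X × Y).2 = (q : X × Y).2) (h : (p : X × Y).1 - (q : X × Y).1 ∈ C) :
    (φ t p : X × Y).1 - (φ t q : X × Y).1 ∈ C := by
  by_cases hne : p = q
  · rw [hne, sub_self]; exact hC.zero_mem
  rcases ht.eq_or_lt with rfl | ht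
  · simpa using h
  · exact interior_subset (hφ.sub_mem_interior hC hC1 hmono ht hpq h hne)

/-- An ordered pair is positively proximal: otherwise its forward orbit would stay uniformly
strongly ordered, and minimality of `K` would put a point of `K` strictly and uniformly below every
point of `K`, contradicting compactness. -/
theorem positivelyProximal_of_sub_mem [CompleteSpace X] (hC : IsStronglyOrdered C)
    (hC1 : IsC1InX Φ) (hmono : IsStronglyMonotone C Φ) (hK : IsMinimalSet Φ K)
    (hφ : IsFlowExtension σ Φ K φ) {p q : K} (hpq : (p : X × Y).2 = (q : X × Y).2)
    (h : (p : X × Y).1 - (q : X × Y).1 ∈ C) : PositivelyProximal φ p q := by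
  intro ε hε
  by_contra! hfar
  have : CompactSpace K := isCompact_iff_compactSpace.1 hK.isCompact
  obtain ⟨hC, e, he⟩ := hC
  have hφc : ∀ t : ℝ, Continuous fun k : K => (φ t k : X × Y).1 := fun t =>
    continuous_fst.comp (continuous_subtype_val.comp (φ.continuous_toFun t))
  have hcl : IsClosed {z : K × K | (z.1 : X × Y).2 = (z.2 : X × Y).2} :=
    isClosed_eq (by fun_prop) (by fun_prop)
  have hdc : ∀ t : ℝ, Continuous fun z : K × K => (φ t z.1 : X × Y).1 - (φ t z.2 : X × Y).1 :=
    fun t => ((hφc t).comp continuous_fst).sub ((hφc t).comp continuous_snd)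
  set N : Set (K × K) := {z | (z.1 : X × Y).2 = (z.2 : X × Y).2} ∩
    ({z | (z.1 : X × Y).1 - (z.2 : X × Y).1 ∈ C} ∩ {z | ε ≤ dist z.1 z.2})
  have hN : IsCompact N := by
    refine IsClosed.isCompact (hcl.inter (IsClosed.inter ?_ ?_))
    · exact hC.isClosed.preimage (by fun_prop)
    · exact isClosed_le continuous_const (by fun_prop)
  obtain ⟨δ, hδ, hNδ⟩ := exists_forall_sub_smul_mem (C := C) (hN.image (hdc 1)) (by
    rintro _ ⟨z, ⟨h1, h2, h3⟩, rfl⟩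
    refine hφ.sub_mem_interior hC hC1 hmono one_pos h1 h2 fun h0 => ?_
    have : ε ≤ dist z.1 z.2 := h3
    rw [h0, dist_self] at this
    linarith) e
  -- pairs that are ordered by at least `δ • e` for all future time; they project onto all of `K`
  set M : Set (K × K) := {z | (z.1 : X × Y).2 = (z.2 : X × Y).2} ∩
    ⋂ t : ℝ, ⋂ _ : 0 ≤ t, {z | (φ t z.1 : X × Y).1 - (φ t z.2 : X × Y).1 - δ • e ∈ C}
  have hM : IsCompact M := by
    refine IsClosed.isCompact (hcl.inter (isClosed_iInter fun t => isClosed_iInter fun _ => ?_))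
    exact hC.isClosed.preimage ((hdc t).sub continuous_const)
  have hMem : (φ 1 p, φ 1 q) ∈ M := by
    refine ⟨hφ.snd_eq_snd 1 hpq, mem_iInter₂.2 fun t ht => ?_⟩
    have h1 := hNδ _ ⟨(φ t p, φ t q), ⟨hφ.snd_eq_snd t hpq, hφ.sub_mem hC hC1 hmono ht hpq h,
      hfar t ht⟩, rfl⟩
    change (φ t (φ 1 p) : X × Y).1 - (φ t (φ 1 q) : X × Y).1 - δ • e ∈ C
    rw [← φ.map_add, ← φ.map_add, add_comm t, φ.map_add, φ.map_add]
    exact h1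
  have huniv : Prod.fst '' M = univ := by
    refine hK.eq_univ_of_isClosed hφ (hM.image continuous_fst).isClosed ⟨_, _, hMem, rfl⟩ ?_
    rintro t ht _ ⟨z, hz, rfl⟩
    refine ⟨(φ t z.1, φ t z.2), ⟨hφ.snd_eq_snd t hz.1, mem_iInter₂.2 fun s hs => ?_⟩, rfl⟩
    change (φ s (φ t z.1) : X × Y).1 - (φ s (φ t z.2) : X × Y).1 - δ • e ∈ C
    rw [← φ.map_add, ← φ.map_add]
    exact mem_iInter₂.1 hz.2 (s + t) (by positivity)
  have hne : -((p : X × Y).1 - (q : X × Y).1) ∉ C := by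
    intro h'
    have h0 := hfar 0 le_rfl
    rw [φ.map_zero, id, id, dist_eq_norm_sub_of_snd_eq hpq, hC.eq_zero h h', norm_zero] at h0
    linarith
  obtain ⟨f, hf, hfe⟩ := hC.exists_positive_functional he hne
  obtain ⟨k, -, hk⟩ := isCompact_univ.exists_isMinOn (⟨p, mem_univ _⟩ : (univ : Set K).Nonempty)
    (f := fun k : K => f (k : X × Y).1) (by fun_prop)
  have hkM : k ∈ Prod.fst '' M := by rw [huniv]; exact mem_univ _
  obtain ⟨z, hz, rfl⟩ := hkM
  have h1 : (φ 0 z.1 : X × Y).1 - (φ 0 z.2 : X × Y).1 - δ • e ∈ C :=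
    mem_iInter₂.1 hz.2 0 le_rfl
  have h2 := hf _ h1
  simp only [φ.map_zero, id, map_sub, map_smul, smul_eq_mul] at h2
  have h3 : f (z.1 : X × Y).1 ≤ f (z.2 : X × Y).1 := hk (mem_univ z.2)
  have h4 : 0 < δ * f e := mul_pos hδ hfe
  linarith

theorem positivelyProximal_of_mem_orderRelation [CompleteSpace X] (hC : IsStronglyOrdered C)
    (hC1 : IsC1InX Φ) (hmono : IsStronglyMonotone C Φ) (hK : IsMinimalSet Φ K)
    (hφ : IsFlowExtension σ Φ K φ) {p q : K} (h : (p, q) ∈ orderRelation C K) :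
    PositivelyProximal φ p q := by
  obtain ⟨h1, h2 | h2⟩ := h
  · exact positivelyProximal_of_sub_mem hC hC1 hmono hK hφ h1 h2
  · refine (positivelyProximal_of_sub_mem hC hC1 hmono hK hφ h1.symm ?_).symm
    simpa using h2

end OrderedPairs

/-! ### Uniform growth of cocycles -/

section Cocycle

variable {X Z : Type*} [NormedAddCommGroup X] [NormedSpace ℝ X]

/-- The product `L (F^[n-1] z) ∘ ⋯ ∘ L (F z) ∘ L z` of the operators met along the orbit of `z`. -/
def cocycle (F : Z → Z) (L : Z → X →L[ℝ] X) : ℕ → Z → X →L[ℝ] X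
  | 0, _ => ContinuousLinearMap.id ℝ X
  | n + 1, z => (cocycle F L n (F z)).comp (L z)

variable {F : Z → Z} {L : Z → X →L[ℝ] X}

theorem cocycle_add (m n : ℕ) (z : Z) :
    cocycle F L (n + m) z = (cocycle F L n (F^[m] z)).comp (cocycle F L m z) := by
  induction m generalizing z with
  | zero => rfl
  | succ m ih =>
    rw [← add_assoc, cocycle, ih, cocycle, ContinuousLinearMap.comp_assoc]
    rfl

theorem cocycle_succ_apply (n : ℕ) (z : Z) (x : X) :
    cocycle F L (n + 1) z x = L (F^[n] z) (cocycle F L n z x) := by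
  rw [add_comm, cocycle_add]
  rfl

theorem norm_cocycle_le {B : ℝ} (hB : 1 ≤ B) (hL : ∀ z, ‖L z‖ ≤ B) (n : ℕ) (z : Z) :
    ‖cocycle F L n z‖ ≤ B ^ n := by
  induction n generalizing z with
  | zero => simpa [cocycle] using ContinuousLinearMap.norm_id_le
  | succ n ih =>
    rw [pow_succ]
    refine (ContinuousLinearMap.opNorm_comp_le _ _).trans ?_
    have := hL z
    have := ih (F z)
    gcongr

theorem continuous_cocycle [TopologicalSpace Z] (hF : Continuous F) (hL : Continuous L) (n : ℕ) :
    Continuous (cocycle F L n) := by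
  induction n with
  | zero => exact continuous_const
  | succ n ih => exact (ih.comp hF).clm_comp hL

/-- Pointwise exponential bounds along a compact set are uniform, and they persist for orbits that
remain close to it. -/
theorem exists_uniform_cocycle_growth [MetricSpace Z] [CompactSpace Z] (hF : Continuous F)
    (hL : Continuous L) {D : Set Z} (hD : IsCompact D) {a : ℝ} (ha : 1 < a)
    (h : ∀ z ∈ D, ∃ m : ℕ, 1 ≤ m ∧ ‖cocycle F L m z‖ < a ^ m) :
    ∃ c δ : ℝ, 0 < c ∧ 0 < δ ∧ ∀ (n : ℕ) (z : Z),
      (∀ j < n, F^[j] z ∈ Metric.thickening δ D) → ‖cocycle F L n z‖ ≤ c * a ^ n := by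
  obtain ⟨B₀, hB₀, hLB₀⟩ := (isCompact_range hL).isBounded.exists_pos_norm_le
  obtain ⟨B, hB⟩ : ∃ B, B = max 1 B₀ := ⟨_, rfl⟩
  have hB1 : 1 ≤ B := by rw [hB]; exact le_max_left _ _
  have hLB : ∀ z, ‖L z‖ ≤ B := fun z => by
    rw [hB]; exact (hLB₀ _ (mem_range_self z)).trans (le_max_right _ _)
  let V : ℕ → Set Z := fun N => {z | ∃ m : ℕ, 1 ≤ m ∧ m ≤ N ∧ ‖cocycle F L m z‖ < a ^ m}
  have hV : ∀ N, IsOpen (V N) := by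
    intro N
    have : V N = ⋃ m : ℕ, ⋃ _ : 1 ≤ m ∧ m ≤ N, {z | ‖cocycle F L m z‖ < a ^ m} := by
      ext z
      simp [V, and_assoc]
    rw [this]
    exact isOpen_iUnion fun m => isOpen_iUnion fun _ =>
      isOpen_lt (continuous_cocycle hF hL m).norm continuous_const
  have hVmono : Monotone V := fun N N' hN z ⟨m, h1, h2, h3⟩ => ⟨m, h1, h2.trans hN, h3⟩
  obtain ⟨N, hN⟩ := hD.elim_directed_cover V hV
    (fun z hz => by
      obtain ⟨m, h1, h2⟩ := h z hz
      exact mem_iUnion.2 ⟨m, m, h1, le_rfl, h2⟩) hVmono.directed_le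
  obtain ⟨δ, hδ, hδV⟩ := hD.exists_thickening_subset_open (hV N) hN
  -- `B ^ N` absorbs the last incomplete block of at most `N` steps
  refine ⟨B ^ N, δ, by positivity, hδ, fun n => ?_⟩
  induction n using Nat.strong_induction_on with
  | _ n ih =>
    intro z hz
    rcases Nat.eq_zero_or_pos n with rfl | hn
    · refine (norm_cocycle_le hB1 hLB 0 z).trans ?_
      simpa using one_le_pow₀ hB1
    obtain ⟨m, h1, h2, h3⟩ := hδV (hz 0 hn)
    rcases le_or_gt m n with hmn | hmn
    · obtain ⟨k, rfl⟩ := Nat.exists_eq_add_of_le' hmn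
      rw [cocycle_add]
      have h4 := ih k (by omega) (F^[m] z) fun j hj => by
        rw [← Function.iterate_add_apply]
        exact hz _ (by omega)
      calc _ ≤ ‖cocycle F L k (F^[m] z)‖ * ‖cocycle F L m z‖ :=
            ContinuousLinearMap.opNorm_comp_le _ _
        _ ≤ B ^ N * a ^ k * a ^ m := by gcongr; exact h3.le
        _ = B ^ N * a ^ (k + m) := by rw [pow_add, mul_assoc]
    · calc ‖cocycle F L n z‖ ≤ B ^ n := norm_cocycle_le hB1 hLB n z
        _ ≤ B ^ N * 1 := by
          rw [mul_one]
          exact pow_le_pow_right₀ hB1 (by omega)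
        _ ≤ B ^ N * a ^ n := by
          have := one_le_pow₀ (n := n) ha.le
          gcongr

end Cocycle

/-! ### Negatively proximal pairs are ordered -/

section PairMap

variable {Z : Type*} [TopologicalSpace Z]

/-- The time-`τ` map on pairs of points. -/
def pairMap (φ : Flow ℝ Z) (τ : ℝ≥0) (z : Z × Z) : Z × Z := (φ τ z.1, φ τ z.2)

theorem iterate_pairMap (φ : Flow ℝ Z) (τ : ℝ≥0) (n : ℕ) (z : Z × Z) :
    (pairMap φ τ)^[n] z = (φ (n * τ) z.1, φ (n * τ) z.2) := by
  induction n with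
  | zero => simp
  | succ n ih =>
    rw [Function.iterate_succ_apply', ih, pairMap, ← φ.map_add, ← φ.map_add]
    push_cast
    rw [add_mul, one_mul, add_comm]

theorem continuous_pairMap (φ : Flow ℝ Z) (τ : ℝ≥0) : Continuous (pairMap φ τ) :=
  ((φ.continuous_toFun τ).comp continuous_fst).prodMk ((φ.continuous_toFun τ).comp continuous_snd)

end PairMap

section Stability

variable {X Y : Type*} [NormedAddCommGroup X] [NormedSpace ℝ X] [MetricSpace Y]
  {C : Set X} {σ : Flow ℝ Y} {Φ : Flow ℝ≥0 (X × Y)} {K : Set (X × Y)} {φ : Flow ℝ K}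

/-- The averaged derivative along the segment spanned by a pair of points of `K`. The base point is
taken from the first component. -/
def pairOperator (Φ : Flow ℝ≥0 (X × Y)) (K : Set (X × Y)) (τ : ℝ≥0) (z : K × K) : X →L[ℝ] X :=
  segmentOperator Φ τ (z.1 : X × Y).1 (z.2 : X × Y).1 (z.1 : X × Y).2

theorem continuous_pairOperator (hC1 : IsC1InX Φ) {τ : ℝ≥0} (hτ : 0 < τ) :
    Continuous (pairOperator Φ K τ) :=
  (hC1.continuous_segmentOperator hτ).comp (by fun_prop :
    Continuous fun z : K × K => (((z.1 : X × Y).1, (z.2 : X × Y).1), (z.1 : X × Y).2))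

theorem pairOperator_apply_sub [CompleteSpace X] (hC1 : IsC1InX Φ) (hφ : IsFlowExtension σ Φ K φ)
    {τ : ℝ≥0} (hτ : 0 < τ) {z : K × K} (hz : (z.1 : X × Y).2 = (z.2 : X × Y).2) :
    pairOperator Φ K τ z ((z.1 : X × Y).1 - (z.2 : X × Y).1)
      = ((pairMap φ τ z).1 : X × Y).1 - ((pairMap φ τ z).2 : X × Y).1 := by
  have h1 := hφ.fst_eq τ.2 z.1
  have h2 := hφ.fst_eq τ.2 z.2
  rw [← hz] at h2
  rw [pairOperator, hC1.segmentOperator_apply_sub hτ]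
  exact (congrArg₂ (· - ·) h1 h2).symm

/-- On the diagonal the products of averaged derivatives are the derivatives of the semiflow. -/
theorem cocycle_pairOperator_diag [CompleteSpace X] (hskew : IsSkewProduct σ Φ) (hC1 : IsC1InX Φ)
    (hφ : IsFlowExtension σ Φ K φ) {τ : ℝ≥0} (hτ : 0 < τ) (n : ℕ) (k : K) :
    cocycle (pairMap φ τ) (pairOperator Φ K τ) (n + 1) (k, k)
      = fiberDeriv Φ (k : X × Y).1 (k : X × Y).2 ((n + 1 : ℕ) * τ) := by
  induction n generalizing k with
  | zero => simp [cocycle, pairOperator, segmentOperator_self]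
  | succ n ih =>
    have h1 : ((n + 1 + 1 : ℕ) : ℝ≥0) * τ = (n + 1 : ℕ) * τ + τ := by push_cast; ring
    have h2 : (0 : ℝ≥0) < (n + 1 : ℕ) * τ := by positivity
    rw [cocycle, pairMap, ih, h1, fiberDeriv_add hskew hC1 h2 hτ, pairOperator,
      segmentOperator_self, hφ.extends_semiflow]

/-- Linear stability bounds the derivatives along each orbit by any exponential. -/
theorem IsLinearlyStable.exists_norm_lt (hst : IsLinearlyStable Φ K) {τ : ℝ≥0} (hτ : 0 < τ)
    {a : ℝ} (ha : 1 < a) {q : X × Y} (hq : q ∈ K) :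
    ∃ n : ℕ, ‖fiberDeriv Φ q.1 q.2 ((n + 1 : ℕ) * τ)‖ < a ^ (n + 1) := by
  have hlog : 0 < Real.log a := Real.log_pos ha
  have hτ' : (0 : ℝ) < τ := hτ
  have h1 : lyapunovExponent Φ q.1 q.2 < ((Real.log a / τ : ℝ) : EReal) := by
    refine lt_of_le_of_lt ((le_iSup₂ (f := fun (q : X × Y) (_ : q ∈ K) =>
      lyapunovExponent Φ q.1 q.2) q hq).trans hst) ?_
    exact_mod_cast div_pos hlog hτ'
  have h2 := eventually_lt_of_limsup_lt h1
  have h3 : Tendsto (fun n : ℕ => ((n + 1 : ℕ) : ℝ≥0) * τ) atTop atTop :=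
    (tendsto_natCast_atTop_atTop.comp (tendsto_add_atTop_nat 1)).atTop_mul_const hτ
  obtain ⟨n, hn⟩ := (h3.eventually h2).exists
  refine ⟨n, ?_⟩
  have ht : (0 : ℝ) < (((n + 1 : ℕ) * τ : ℝ≥0) : ℝ) := by
    have : (0 : ℝ≥0) < (n + 1 : ℕ) * τ := by positivity
    exact this
  rw [EReal.div_lt_iff (by exact_mod_cast ht) (EReal.coe_ne_top _), ← EReal.coe_mul] at hn
  by_contra! hcon
  refine absurd hn (not_lt.2 ?_)
  have h4 : Real.log a / τ * (((n + 1 : ℕ) * τ : ℝ≥0) : ℝ) = Real.log (a ^ (n + 1)) := by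
    rw [Real.log_pow, NNReal.coe_mul, NNReal.coe_natCast]
    field_simp
  rw [h4, ← ENNReal.log_ofReal_of_pos (by positivity)]
  refine ENNReal.log_le_log_iff.2 ?_
  rw [← ofReal_norm]
  exact ENNReal.ofReal_le_ofReal hcon

/-- Stability of unordered pairs: two close points of `K` over the same base point, whose orbits
are still unordered after `n` steps, are at most `c` times further apart than at the start. The
exponential separation beats the subexponential growth along the diagonal. -/
theorem exists_unordered_stability [CompleteSpace X] (hC : IsCone C) {e : X}
    (he : e ∈ interior C) (he0 : e ≠ 0) (hskew : IsSkewProduct σ Φ)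
    (hC1 : IsC1InX Φ) (hmono : IsStronglyMonotone C Φ) (hK : IsMinimalSet Φ K)
    (hφ : IsFlowExtension σ Φ K φ) {τ : ℝ≥0} (hτ : 0 < τ)
    (hcompact : ∀ q ∈ fiberHull K, IsCompactOperator (fiberDeriv Φ q.1 q.2 τ))
    (hst : IsLinearlyStable Φ K) :
    ∃ c δ : ℝ, 0 < c ∧ 0 < δ ∧ ∀ p q : K, (p : X × Y).2 = (q : X × Y).2 → dist p q < δ →
      ∀ n : ℕ, (φ (n * τ) p : X × Y).1 - (φ (n * τ) q : X × Y).1 ∉ C →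
        -((φ (n * τ) p : X × Y).1 - (φ (n * τ) q : X × Y).1) ∉ C →
          ‖(φ (n * τ) p : X × Y).1 - (φ (n * τ) q : X × Y).1‖ ≤ c * dist p q := by
  have : CompactSpace K := isCompact_iff_compactSpace.1 hK.isCompact
  set F := pairMap φ τ
  set L := pairOperator Φ K τ
  have hF : Continuous F := continuous_pairMap φ τ
  have hL : Continuous L := continuous_pairOperator hC1 hτ
  set Z : Set (K × K) := {z | (z.1 : X × Y).2 = (z.2 : X × Y).2}
  have hZ : IsClosed Z := isClosed_eq (by fun_prop) (by fun_prop)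
  have hfam : IsPositiveFamily C e (L '' Z) := by
    refine ⟨hC, he, he0, hZ.isCompact.image hL, ?_, ?_⟩
    · rintro _ ⟨z, hz, rfl⟩
      refine segmentOperator_isCompactOperator hC1 hτ fun θ hθ => hcompact _
        ⟨(z.1 : X × Y).1, (z.2 : X × Y).1, (z.1 : X × Y).2, θ, z.1.2, ?_, hθ, rfl⟩
      have hz' : (z.1 : X × Y).2 = (z.2 : X × Y).2 := hz
      rw [hz']
      exact z.2.2
    · rintro _ ⟨z, -, rfl⟩
      exact segmentOperator_isStronglyPositive hC hC1 hmono hτ _ _ _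
  obtain ⟨c, θ, hc, hθ0, hθ1, hsep⟩ := hfam.exponential_separation
  -- the growth rate `a` is chosen so that `θ * a ^ 2 = 1`
  obtain ⟨a, ha⟩ : ∃ a, a = (√θ)⁻¹ := ⟨_, rfl⟩
  have hsq : 0 < √θ := Real.sqrt_pos.2 hθ0
  have ha1 : 1 < a := by
    rw [ha]
    refine (one_lt_inv₀ hsq).2 ?_
    rw [Real.sqrt_lt' one_pos]
    simpa using hθ1
  have haθ : θ * a ^ 2 = 1 := by
    rw [ha, inv_pow, Real.sq_sqrt hθ0.le, mul_inv_cancel₀ hθ0.ne']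
  have hθa : ∀ n : ℕ, θ ^ (n / 2) * a ^ n ≤ a := by
    intro n
    have h1 : a ^ n = (a ^ 2) ^ (n / 2) * a ^ (n % 2) := by
      rw [← pow_mul, ← pow_add, Nat.div_add_mod]
    rw [h1, ← mul_assoc, ← mul_pow, haθ, one_pow, one_mul]
    calc a ^ (n % 2) ≤ a ^ 1 := pow_le_pow_right₀ ha1.le (by omega)
      _ = a := pow_one a
  obtain ⟨c₁, δ, hc₁, hδ, hgrow⟩ := exists_uniform_cocycle_growth hF hL
    (D := range fun k : K => (k, k)) (isCompact_range (by fun_prop)) ha1 (by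
      rintro _ ⟨k, rfl⟩
      obtain ⟨n, hn⟩ := hst.exists_norm_lt hτ ha1 k.2
      refine ⟨n + 1, by omega, ?_⟩
      rwa [cocycle_pairOperator_diag hskew hC1 hφ hτ])
  have hnear : ∀ z : K × K, dist z.1 z.2 < δ →
      z ∈ Metric.thickening δ (range fun k : K => (k, k)) :=
    fun z hz => Metric.mem_thickening_iff.2 ⟨(z.1, z.1), mem_range_self _, by
      rw [Prod.dist_eq, dist_self, dist_comm]
      exact max_lt hδ hz⟩
  obtain ⟨c₂, hc₂⟩ : ∃ c₂, c₂ = max 1 (c * a * c₁ * ‖e‖) := ⟨_, rfl⟩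
  have hc₂1 : 1 ≤ c₂ := by rw [hc₂]; exact le_max_left _ _
  have hc₂0 : 0 < c₂ := by linarith
  refine ⟨c₂, δ / c₂, hc₂0, by positivity, fun p q hpq hd n => ?_⟩
  have hd' : c₂ * dist p q < δ := by rwa [lt_div_iff₀ hc₂0, mul_comm] at hd
  have hFz : ∀ j, F^[j] (p, q) = (φ (j * τ) p, φ (j * τ) q) := fun j => iterate_pairMap φ τ j (p, q)
  have hZj : ∀ j : ℕ, (φ (j * τ) p : X × Y).2 = (φ (j * τ) q : X × Y).2 :=
    fun j => hφ.snd_eq_snd _ hpq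
  -- the bound at earlier times keeps the pair close to the diagonal, which gives the bound at `n`
  induction n using Nat.strong_induction_on with
  | _ n ih =>
    intro h1 h2
    have hback : ∀ j < n, (φ (j * τ) p : X × Y).1 - (φ (j * τ) q : X × Y).1 ∉ C ∧
        -((φ (j * τ) p : X × Y).1 - (φ (j * τ) q : X × Y).1) ∉ C := by
      intro j hj
      have hle : (0 : ℝ) ≤ (n - j : ℝ) * τ := by
        have : (j : ℝ) ≤ n := by exact_mod_cast hj.le
        exact mul_nonneg (by linarith) τ.2
      have hadd : (n : ℝ) * τ = (n - j : ℝ) * τ + j * τ := by ring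
      rw [neg_sub] at h2 ⊢
      rw [hadd, φ.map_add, φ.map_add] at h1 h2
      exact ⟨fun h => h1 (hφ.sub_mem hC hC1 hmono hle (hZj j) h),
        fun h => h2 (hφ.sub_mem hC hC1 hmono hle (hZj j).symm h)⟩
    have hclose : ∀ j < n, F^[j] (p, q) ∈ Metric.thickening δ (range fun k : K => (k, k)) := by
      intro j hj
      rw [hFz]
      refine hnear _ ?_
      rw [dist_eq_norm_sub_of_snd_eq (hZj j)]
      exact (ih j hj (hback j hj).1 (hback j hj).2).trans_lt hd'
    have hs := hsep (fun j => L (F^[j] (p, q)))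
      (fun j => ⟨_, by rw [hFz]; exact hZj j, rfl⟩)
      (fun j => cocycle F L j (p, q) e)
      (fun j => (φ (j * τ) p : X × Y).1 - (φ (j * τ) q : X × Y).1) rfl
      (fun j => cocycle_succ_apply j _ e)
      (fun j => by
        have h3 := hFz (j + 1)
        rw [Function.iterate_succ_apply', hFz] at h3
        have h4 := pairOperator_apply_sub hC1 hφ hτ (z := (φ (j * τ) p, φ (j * τ) q)) (hZj j)
        rw [show pairMap φ τ (φ (j * τ) p, φ (j * τ) q) = _ from h3] at h4
        rw [hFz]
        exact h4.symm) n h1 h2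
    have h0 : ‖(φ ((0 : ℕ) * τ) p : X × Y).1 - (φ ((0 : ℕ) * τ) q : X × Y).1‖ = dist p q := by
      rw [Nat.cast_zero, zero_mul, φ.map_zero, id, id, dist_eq_norm_sub_of_snd_eq hpq]
    simp only [h0] at hs
    have hv : ‖cocycle F L n (p, q) e‖ ≤ c₁ * a ^ n * ‖e‖ :=
      ContinuousLinearMap.le_of_opNorm_le _ (hgrow n _ hclose) e
    calc _ ≤ c * θ ^ (n / 2) * (c₁ * a ^ n * ‖e‖) * dist p q := hs.trans (by gcongr)
      _ = c * c₁ * ‖e‖ * (θ ^ (n / 2) * a ^ n) * dist p q := by ring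
      _ ≤ c * c₁ * ‖e‖ * a * dist p q := by
        have := hθa n
        gcongr
      _ = c * a * c₁ * ‖e‖ * dist p q := by ring
      _ ≤ c₂ * dist p q := by
        rw [hc₂]
        exact mul_le_mul_of_nonneg_right (le_max_right _ _) dist_nonneg

/-- Negative proximality can be tested on negative multiples of a time step. -/
theorem NegativelyProximal.exists_multiple {Z : Type*} [MetricSpace Z] [CompactSpace Z]
    {φ : Flow ℝ Z} {p q : Z} (h : NegativelyProximal φ p q) {τ : ℝ} (hτ : 0 < τ) {ε : ℝ}
    (hε : 0 < ε) : ∃ n : ℕ, dist (φ (-(n * τ)) p) (φ (-(n * τ)) q) < ε := by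
  have hu : UniformContinuous fun z : Icc (0 : ℝ) τ × Z => φ z.1 z.2 :=
    CompactSpace.uniformContinuous_of_continuous (φ.continuous (by fun_prop) (by fun_prop))
  obtain ⟨δ, hδ, hd⟩ := Metric.uniformContinuous_iff.1 hu ε hε
  obtain ⟨t, ht, htd⟩ := h δ hδ
  have h0 : 0 ≤ -t / τ := div_nonneg (by linarith) hτ.le
  have h1 := Nat.floor_le h0
  have h2 := Nat.lt_floor_add_one (-t / τ)
  rw [le_div_iff₀ hτ] at h1
  rw [div_lt_iff₀ hτ] at h2
  refine ⟨⌊-t / τ⌋₊, ?_⟩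
  have hs : -(⌊-t / τ⌋₊ * τ) - t ∈ Icc (0 : ℝ) τ := ⟨by linarith, by linarith⟩
  have h3 := hd (a := (⟨_, hs⟩, φ t p)) (b := (⟨_, hs⟩, φ t q)) (by
    rw [Prod.dist_eq, dist_self]
    exact max_lt hδ htd)
  simpa only [← φ.map_add, sub_add_cancel] using h3

/-- A negatively proximal pair is ordered: otherwise stability of unordered pairs, applied from
times in the past at which the pair is arbitrarily close, would force it to coincide. -/
theorem mem_orderRelation_of_negativelyProximal [CompleteSpace X] (hC : IsStronglyOrdered C)
    (hσ : IsDistalFlow σ) (hskew : IsSkewProduct σ Φ)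
    (hC1 : IsC1InX Φ) (hmono : IsStronglyMonotone C Φ) (hK : IsMinimalSet Φ K)
    (hφ : IsFlowExtension σ Φ K φ) {τ : ℝ≥0} (hτ : 0 < τ)
    (hcompact : ∀ q ∈ fiberHull K, IsCompactOperator (fiberDeriv Φ q.1 q.2 τ))
    (hst : IsLinearlyStable Φ K) {p q : K} (h : NegativelyProximal φ p q) :
    (p, q) ∈ orderRelation C K := by
  have : CompactSpace K := isCompact_iff_compactSpace.1 hK.isCompact
  obtain ⟨hC, e, he⟩ := hC
  have hpq := hφ.snd_eq_of_proximal hσ h.proximal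
  by_contra hcon
  have hun : (p : X × Y).1 - (q : X × Y).1 ∉ C ∧ -((p : X × Y).1 - (q : X × Y).1) ∉ C :=
    ⟨fun h1 => hcon ⟨hpq, Or.inl h1⟩, fun h1 => hcon ⟨hpq, Or.inr h1⟩⟩
  have he0 : e ≠ 0 := by
    rintro rfl
    obtain ⟨b, -, hb⟩ := hC.exists_orderUnit_bound he
    exact hun.1 (by simpa using hb ((p : X × Y).1 - (q : X × Y).1))
  obtain ⟨c, δ, hc, hδ, hstab⟩ := exists_unordered_stability hC he he0 hskew hC1 hmono hK hφ hτ
    hcompact hst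
  have hpos : 0 < ‖(p : X × Y).1 - (q : X × Y).1‖ :=
    norm_pos_iff.2 fun h0 => hun.1 (by rw [h0]; exact hC.zero_mem)
  obtain ⟨n, hn⟩ := h.exists_multiple (show (0 : ℝ) < τ from hτ)
    (lt_min hδ (div_pos hpos hc))
  have hback : ∀ k : K, φ (n * τ) (φ (-(n * τ)) k) = k := fun k => by
    rw [← φ.map_add, add_neg_cancel, φ.map_zero, id]
  have h1 := hstab _ _ (hφ.snd_eq_snd (-(n * τ)) hpq) (hn.trans_le (min_le_left _ _)) n
    (by rw [hback, hback]; exact hun.1) (by rw [hback, hback]; exact hun.2)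
  rw [hback, hback] at h1
  have h2 := hn.trans_le (min_le_right _ _)
  rw [lt_div_iff₀ hc] at h2
  linarith

end Stability

/-! ### The enveloping semigroup -/

section Enveloping

variable {Z : Type*} [MetricSpace Z]

/-- Points identified by a limit of time maps are proximal. -/
theorem proximal_of_limit {φ : Flow ℝ Z} {p q : Z} {g : Z → Z}
    (hg : g ∈ closure (range fun t : ℝ => (φ t : Z → Z))) (h : g p = g q) : Proximal φ p q := by
  refine proximal_iff.2 fun ε hε => ?_
  have hd : Continuous fun g : Z → Z => dist (g p) (g q) :=
    (continuous_apply p).dist (continuous_apply q)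
  have ho : IsOpen {g : Z → Z | dist (g p) (g q) < ε} := isOpen_lt hd continuous_const
  obtain ⟨_, h1, t, rfl⟩ := mem_closure_iff.1 hg _ ho (by
    change dist (g p) (g q) < ε
    rwa [h, dist_self])
  exact ⟨t, h1⟩

/-- A set of self-maps that is closed and invariant under a family of continuous maps `φ t` absorbs
the limits of that family from the left. -/
theorem comp_mem_of_mem_closure {φ : Flow ℝ Z} {I : Set (Z → Z)} (hI : IsClosed I) {S : Set ℝ}
    (hinv : ∀ t ∈ S, ∀ r ∈ I, φ t ∘ r ∈ I) {g r : Z → Z}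
    (hg : g ∈ closure ((fun t : ℝ => (φ t : Z → Z)) '' S)) (hr : r ∈ I) : g ∘ r ∈ I := by
  have hc : Continuous fun g : Z → Z => g ∘ r :=
    continuous_pi fun z => continuous_apply (r z)
  have h := closure_minimal (t := (fun g : Z → Z => g ∘ r) ⁻¹' I)
    (image_subset_iff.2 fun t ht => hinv t ht r hr) (hI.preimage hc)
  exact h hg

variable [CompactSpace Z]

/-- Positive proximality is witnessed by an element of the closure of the forward time maps in the
space of all self-maps with the topology of pointwise convergence. -/
theorem PositivelyProximal.exists_limit {φ : Flow ℝ Z} {p q : Z} (h : PositivelyProximal φ p q) :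
    ∃ g ∈ closure ((fun t : ℝ => (φ t : Z → Z)) '' Ici 0), g p = g q := by
  have hd : Continuous fun g : Z → Z => dist (g p) (g q) :=
    (continuous_apply p).dist (continuous_apply q)
  have hcl : IsClosed (closure ((fun t : ℝ => (φ t : Z → Z)) '' Ici 0)) := isClosed_closure
  obtain ⟨g, hg, hmin⟩ := hcl.isCompact.exists_isMinOn
    ⟨_, subset_closure ⟨0, self_mem_Ici, rfl⟩⟩ hd.continuousOn
  refine ⟨g, hg, dist_le_zero.1 (le_of_forall_pos_le_add fun ε hε => ?_)⟩
  obtain ⟨t, ht, htd⟩ := h ε hε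
  have h1 := hmin (subset_closure ⟨t, ht, rfl⟩)
  rw [zero_add]
  exact le_trans h1 htd.le

/-- A minimal closed invariant set `I` of limits of the negative time maps: the flow acts on the
compact space of all self-maps by composition, and `I` is a minimal set of this action. -/
theorem exists_minimal_negative_limits [Nonempty Z] (φ : Flow ℝ Z) :
    ∃ I : Set (Z → Z), IsClosed I ∧ I.Nonempty ∧
      I ⊆ closure ((fun t : ℝ => (φ t : Z → Z)) '' Iic 0) ∧
      (∀ t : ℝ, ∀ r ∈ I, φ t ∘ r ∈ I) ∧
      ∀ J ⊆ I, IsClosed J → J.Nonempty → (∀ t : ℝ, ∀ r ∈ J, φ t ∘ r ∈ J) → J = I := by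
  set E : Set (Z → Z) := ⋂ T : ℝ, closure ((fun t : ℝ => (φ t : Z → Z)) '' Iic T) with hE
  have hcomp : ∀ t : ℝ, Continuous fun r : Z → Z => φ t ∘ r := fun t =>
    continuous_pi fun z => (φ.continuous_toFun t).comp (continuous_apply z)
  have hEinv : ∀ t : ℝ, ∀ r ∈ E, φ t ∘ r ∈ E := by
    intro t r hr
    refine mem_iInter.2 fun T => ?_
    have h1 := mem_iInter.1 hr (T - t)
    refine map_mem_closure (hcomp t) h1 ?_
    rintro _ ⟨s, hs, rfl⟩
    refine ⟨t + s, ?_, ?_⟩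
    · have : s ≤ T - t := hs
      change t + s ≤ T
      linarith
    · funext z
      exact φ.map_add t s z
  have hEcl : IsClosed E := isClosed_iInter fun _ => isClosed_closure
  have hEne : E.Nonempty := by
    refine IsCompact.nonempty_iInter_of_directed_nonempty_isCompact_isClosed _ ?_ ?_ ?_ ?_
    · refine directed_of_isDirected_ge fun T T' hT => ?_
      exact closure_mono (image_mono (Iic_subset_Iic.2 hT))
    · exact fun T => ⟨_, subset_closure ⟨T, self_mem_Iic, rfl⟩⟩
    · exact fun T => isClosed_closure.isCompact
    · exact fun T => isClosed_closure
  let S : Set (Set (Z → Z)) := {I | IsClosed I ∧ I.Nonempty ∧ ∀ t : ℝ, ∀ r ∈ I, φ t ∘ r ∈ I}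
  obtain ⟨I, hIE, hI⟩ := zorn_superset_nonempty S (by
    intro c hc hchain hne
    refine ⟨⋂₀ c, ⟨?_, ?_, ?_⟩, fun s hs => sInter_subset_of_mem hs⟩
    · exact isClosed_sInter fun s hs => (hc hs).1
    · have := hne.to_subtype
      rw [sInter_eq_iInter]
      refine IsCompact.nonempty_iInter_of_directed_nonempty_isCompact_isClosed _ ?_ ?_ ?_ ?_
      · refine directedOn_iff_directed.1 fun s hs s' hs' => ?_
        rcases hchain.total hs hs' with h | h
        · exact ⟨s, hs, subset_rfl, h⟩
        · exact ⟨s', hs', h, subset_rfl⟩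
      · exact fun s => (hc s.2).2.1
      · exact fun s => (hc s.2).1.isCompact
      · exact fun s => (hc s.2).1
    · exact fun t r hr s hs => (hc hs).2.2 t r (hr s hs)) E ⟨hEcl, hEne, hEinv⟩
  refine ⟨I, hI.prop.1, hI.prop.2.1, fun r hr => mem_iInter.1 (hIE hr) 0, hI.prop.2.2,
    fun J hJI hJ1 hJ2 hJ3 => ?_⟩
  exact hJI.antisymm (hI.le_of_le ⟨hJ1, hJ2, hJ3⟩ hJI)

/-- Ellis–Numakura for self-maps under composition. -/
theorem exists_idempotent_selfMap {S : Set (Z → Z)} (hS : IsClosed S) (hne : S.Nonempty)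
    (hcomp : ∀ f ∈ S, ∀ g ∈ S, f ∘ g ∈ S) : ∃ e ∈ S, e ∘ e = e := by
  let _ : Semigroup (Z → Z) := { mul := fun f g => f ∘ g, mul_assoc := fun _ _ _ => rfl }
  exact exists_idempotent_in_compact_subsemigroup
    (fun r => continuous_pi fun z => continuous_apply (r z)) S hne hS.isCompact hcomp

/-- Relative to a point `p` of a minimal flow, an idempotent `e` of a minimal invariant set of
negative limits fixes `p`, moves every `q` to a negatively proximal point, and makes the pair
`p, e q` almost periodic. The last property is recorded in the form that is needed: `p` and `e q`
coincide as soon as some composition of two forward limits identifies them. -/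
theorem exists_idempotent_fixing (φ : Flow ℝ Z)
    (hmin : ∀ A : Set Z, IsClosed A → A.Nonempty → (∀ t : ℝ, 0 ≤ t → ∀ z ∈ A, φ t z ∈ A) →
      A = univ) (p : Z) :
    ∃ e : Z → Z, e p = p ∧ (∀ q, NegativelyProximal φ q (e q)) ∧
      ∀ q, ∀ g ∈ closure ((fun t : ℝ => (φ t : Z → Z)) '' Ici 0),
        ∀ g' ∈ closure ((fun t : ℝ => (φ t : Z → Z)) '' Ici 0),
          g' (g p) = g' (g (e q)) → p = e q := by
  have : Nonempty Z := ⟨p⟩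
  obtain ⟨I, hIcl, hIne, hIneg, hIinv, hImin⟩ := exists_minimal_negative_limits φ
  have hev : ∀ z : Z, Continuous fun r : Z → Z => r z := continuous_apply
  have himg : (fun r : Z → Z => r p) '' I = univ := by
    refine hmin _ (hIcl.isCompact.image (hev p)).isClosed (hIne.image _) ?_
    rintro t - _ ⟨r, hr, rfl⟩
    exact ⟨_, hIinv t r hr, rfl⟩
  have hp : p ∈ (fun r : Z → Z => r p) '' I := by rw [himg]; exact mem_univ p
  have hIcomp : ∀ f ∈ I, ∀ g ∈ I, f ∘ g ∈ I := fun f hf g hg =>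
    comp_mem_of_mem_closure hIcl (fun t _ => hIinv t) (hIneg hf) hg
  obtain ⟨e, ⟨heI, hep⟩, hee⟩ := exists_idempotent_selfMap (S := I ∩ {r | r p = p})
    (hIcl.inter (isClosed_eq (hev p) continuous_const))
    (by obtain ⟨r, hr, hrp⟩ := hp; exact ⟨r, hr, hrp⟩)
    (fun f hf g hg => ⟨hIcomp f hf.1 g hg.1, by
      change f (g p) = p
      rw [show g p = p from hg.2]
      exact hf.2⟩)
  have hep' : e p = p := hep
  refine ⟨e, hep', fun q ε hε => ?_, fun q g hg g' hg' heq => ?_⟩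
  · have hd : Continuous fun g : Z → Z => dist (g q) (g (e q)) := (hev q).dist (hev (e q))
    have ho : IsOpen {g : Z → Z | dist (g q) (g (e q)) < ε} := isOpen_lt hd continuous_const
    obtain ⟨_, h1, t, ht, rfl⟩ := mem_closure_iff.1 (hIneg heI) _ ho (by
      change dist (e q) (e (e q)) < ε
      rw [show e (e q) = e q from congrFun hee q, dist_self]
      exact hε)
    exact ⟨t, ht, h1⟩
  · -- the elements of `I` that identify `p` and `q` form a closed invariant subset of `I`
    have hJ := hImin (I ∩ {r | r p = r q}) inter_subset_left
      (hIcl.inter (isClosed_eq (hev p) (hev q)))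
      ⟨g' ∘ (g ∘ e), comp_mem_of_mem_closure hIcl (fun t _ => hIinv t) hg'
        (comp_mem_of_mem_closure hIcl (fun t _ => hIinv t) hg heI), by
          change g' (g (e p)) = g' (g (e q))
          rwa [hep']⟩
      (fun t r hr => ⟨hIinv t r hr.1, congrArg (φ t) hr.2⟩)
    have h1 : e ∈ I ∩ {r | r p = r q} := by rw [hJ]; exact heI
    rw [← show e p = e q from h1.2, hep']

end Enveloping

/-! ### Proximality and order -/

section Main

theorem orderRelation_symm {X Y : Type*} [NormedAddCommGroup X] {C : Set X} {K : Set (X × Y)}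
    {p q : K} (h : (p, q) ∈ orderRelation C K) : (q, p) ∈ orderRelation C K := by
  refine ⟨h.1.symm, h.2.symm.imp (fun h1 => ?_) fun h1 => ?_⟩
  · simpa using h1
  · simpa using h1

variable {X Y : Type*} [NormedAddCommGroup X] [NormedSpace ℝ X] [MetricSpace Y]
  {C : Set X} {σ : Flow ℝ Y} {Φ : Flow ℝ≥0 (X × Y)} {K : Set (X × Y)} {φ : Flow ℝ K}

/-- Forward limits of the time maps preserve the order relation. -/
theorem limit_mem_orderRelation [CompleteSpace X] (hC : IsCone C)
    (hC1 : IsC1InX Φ) (hmono : IsStronglyMonotone C Φ) (hφ : IsFlowExtension σ Φ K φ)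
    {g : K → K} (hg : g ∈ closure ((fun t : ℝ => (φ t : K → K)) '' Ici 0)) {p q : K}
    (h : (p, q) ∈ orderRelation C K) : (g p, g q) ∈ orderRelation C K := by
  have hev : ∀ k : K, Continuous fun g : K → K => (g k : X × Y) := fun k =>
    continuous_subtype_val.comp (continuous_apply k)
  have h2 : IsClosed {g : K → K | (g p : X × Y).2 = (g q : X × Y).2} :=
    isClosed_eq (continuous_snd.comp (hev p)) (continuous_snd.comp (hev q))
  have h1 : Continuous fun g : K → K => (g p : X × Y).1 - (g q : X × Y).1 :=
    (continuous_fst.comp (hev p)).sub (continuous_fst.comp (hev q))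
  have hcl : IsClosed {g : K → K | (g p, g q) ∈ orderRelation C K} :=
    h2.inter ((hC.isClosed.preimage h1).union (hC.isClosed.neg.preimage h1))
  refine closure_minimal ?_ hcl hg
  rintro _ ⟨t, ht, rfl⟩
  refine ⟨hφ.snd_eq_snd t h.1, h.2.imp (hφ.sub_mem hC hC1 hmono ht h.1) fun hneg => ?_⟩
  have h3 := hφ.sub_mem hC hC1 hmono ht h.1.symm (by simpa using hneg)
  rw [Set.mem_neg, neg_sub]
  exact h3

/-- A positively proximal pair `p, q` is ordered as soon as negatively proximal pairs are. The
idempotent replaces `q` by a point `q'` that is negatively proximal, hence ordered, to `q`; pushing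
`p, q, q'` to a common limit of `p` and `q`, and once more to a common limit with `q'`, shows
`p = q'`. -/
theorem mem_orderRelation_of_positivelyProximal [CompleteSpace X] (hC : IsStronglyOrdered C)
    (hC1 : IsC1InX Φ) (hmono : IsStronglyMonotone C Φ) (hK : IsMinimalSet Φ K)
    (hφ : IsFlowExtension σ Φ K φ)
    (hneg : ∀ p q : K, NegativelyProximal φ p q → (p, q) ∈ orderRelation C K)
    {p q : K} (h : PositivelyProximal φ p q) : (p, q) ∈ orderRelation C K := by
  have : CompactSpace K := isCompact_iff_compactSpace.1 hK.isCompact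
  obtain ⟨e, -, heneg, he⟩ := exists_idempotent_fixing φ
    (fun A hA hne hinv => hK.eq_univ_of_isClosed hφ hA hne hinv) p
  have hord := hneg q (e q) (heneg q)
  obtain ⟨g, hg, hgpq⟩ := h.exists_limit
  have hord' := limit_mem_orderRelation hC.1 hC1 hmono hφ hg hord
  rw [← hgpq] at hord'
  obtain ⟨g', hg', hgeq⟩ :=
    (positivelyProximal_of_mem_orderRelation hC hC1 hmono hK hφ hord').exists_limit
  rw [he q g hg g' hg' hgeq]
  exact orderRelation_symm hord

end Main

end SkewProduct

end

theorem mainTheorem4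
    {X Y : Type*} [NormedAddCommGroup X] [NormedSpace ℝ X] [CompleteSpace X]
    [MetricSpace Y] [CompactSpace Y]
    (C : Set X) (σ : Flow ℝ Y) (Φ : Flow ℝ≥0 (X × Y)) (K : Set (X × Y)) (φ : Flow ℝ K)
    (hYmin : SkewProduct.IsMinimalFlow σ)
    (hYdistal : SkewProduct.IsDistalFlow σ)
    (hC : SkewProduct.IsStronglyOrdered C)
    (hskew : SkewProduct.IsSkewProduct σ Φ)
    (hC1 : SkewProduct.IsC1InX Φ)
    (hmono : SkewProduct.IsStronglyMonotone C Φ)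
    (hK : SkewProduct.IsMinimalSet Φ K)
    (hφ : SkewProduct.IsFlowExtension σ Φ K φ)
    (hcompact : ∃ τ : ℝ≥0, 0 < τ ∧ ∀ q ∈ SkewProduct.fiberHull K,
      IsCompactOperator (SkewProduct.fiberDeriv Φ q.1 q.2 τ))
    (hstable : SkewProduct.IsLinearlyStable Φ K) :
    Equivalence (fun p q : K => (p, q) ∈ SkewProduct.proximalRelation φ) ∧
      SkewProduct.proximalRelation φ = SkewProduct.orderRelation C K := by
  have : CompactSpace K := isCompact_iff_compactSpace.1 hK.isCompact
  obtain ⟨τ, hτ, hcompact⟩ := hcompact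
  have hneg : ∀ p q : K, SkewProduct.NegativelyProximal φ p q →
      (p, q) ∈ SkewProduct.orderRelation C K := fun p q h =>
    SkewProduct.mem_orderRelation_of_negativelyProximal hC hYdistal hskew hC1 hmono hK hφ hτ
      hcompact hstable h
  have hpos : ∀ {p q : K}, (p, q) ∈ SkewProduct.orderRelation C K →
      SkewProduct.PositivelyProximal φ p q := fun h =>
    SkewProduct.positivelyProximal_of_mem_orderRelation hC hC1 hmono hK hφ h
  have hPO : ∀ p q : K, SkewProduct.Proximal φ p q ↔ (p, q) ∈ SkewProduct.orderRelation C K :=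
    fun p q => ⟨fun h => h.positively_or_negatively.elim
      (SkewProduct.mem_orderRelation_of_positivelyProximal hC hC1 hmono hK hφ hneg) (hneg p q),
      fun h => (hpos h).proximal⟩
  refine ⟨⟨fun p => (hPO p p).2 ⟨rfl, Or.inl ?_⟩, fun {p q} h => ?_, fun {p q r} hpq hqr => ?_⟩, ?_⟩
  · rw [sub_self]
    exact hC.1.zero_mem
  · exact (hPO q p).2 (SkewProduct.orderRelation_symm ((hPO p q).1 h))
  · -- collapse `p` and `q` by a limit `g`, which keeps `q` and `r` ordered, then collapse the rest
    obtain ⟨g, hg, hgpq⟩ := (hpos ((hPO p q).1 hpq)).exists_limit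
    have h1 := SkewProduct.limit_mem_orderRelation hC.1 hC1 hmono hφ hg ((hPO q r).1 hqr)
    obtain ⟨g', hg', hgqr⟩ := (hpos h1).exists_limit
    refine SkewProduct.proximal_of_limit (g := g' ∘ g)
      (SkewProduct.comp_mem_of_mem_closure isClosed_closure (S := Ici 0) (fun t _ f hf => ?_) hg'
        (closure_mono (image_subset_range _ _) hg)) ?_
    · refine map_mem_closure (continuous_pi fun z =>
        (φ.continuous_toFun t).comp (continuous_apply z)) hf ?_
      rintro _ ⟨s, rfl⟩
      exact ⟨t + s, funext fun z => φ.map_add t s z⟩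
    · change g' (g p) = g' (g r)
      rw [hgpq, hgqr]
  · ext ⟨p, q⟩
    exact hPO p q
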